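/- Let $n\ge 1$, $d\ge 1$, let $F\in\mathbb{C}[Z_0,\dots,Z_n]$ be homogeneous of degree $d$, write $F_k=\partial F/\partial Z_k$, and suppose that $F_0,\dots,F_n$ have no common zero on $\{F=0\}$ in $\mathbb{C}^{n+1}\setminus\{0\}$, so that $M=\{F=0\}\subset\mathbb{CP}^n$ is a nonsingular hypersurface. Let $\omega=\omega_{FS}|_M$ be the restriction to $M$ of the Fubini–Study form, which in the affine coordinates $z_i=Z_i/Z_0$ is $$\omega_{FS}=\frac{\sqrt{-1}}{2\pi}\sum_{i,j=1}^n\left(\frac{\delta_{ij}}{1+|z|^2}-\frac{\bar z_i z_j}{(1+|z|^2)^2}\right)dz_i\wedge d\bar z_j .$$ In local holomorphic coordinates $(u_1,\dots,u_{n-1})$ on $M$ write $\omega=\frac{\sqrt{-1}}{2\pi}\sum g_{i\bar j}\,du_i\wedge d\bar u_j$, let $(g^{\ell\bar s})$ be defined by $\sum_s g_{k\bar s}g^{\ell\bar s}=\delta_{k\ell}$, and let $\Theta=(\Theta_k^\ell)$ be the curvature matrix of the metric $g$ on the holomorphic tangent bundle of $M$, that is $$\Theta_k^\ell=\frac{\sqrt{-1}}{2\pi}\sum_{i,j}R^{\ell}_{k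 i\bar j}\,du_i\wedge d\bar u_j,\qquad R^{\ell}_{k i\bar j}=-\frac{\partial}{\partial\bar u_j}\left(\sum_s\frac{\partial g_{k\bar s}}{\partial u_i}\,g^{\ell\bar s}\right).$$ Let $\xi$ be the function $$\xi=\log\left(\frac{\sum_{k=0}^n|F_k|^2}{\left(\sum_{k=0}^n|Z_k|^2\right)^{d-1}}\right)$$ on $M$. Then, in every local holomorphic coordinate system on $M$ and for every integer $j\ge 2$, $$\sum_{i_1,\dots,i_j=1}^{n-1}\Theta_{i_1}^{i_2}\wedge\Theta_{i_2}^{i_3}\wedge\cdots\wedge\Theta_{i_{j-1}}^{i_j}\wedge\Theta_{i_j}^{i_1}=(n+1)\,\omega^j-\left(d\,\omega+\frac{\sqrt{-1}}{2\pi}\partial\bar\partial\xi\right)^j .$$ -/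

import Mathlib

open scoped LinearAlgebra.Projectivization

noncomputable section

namespace ProjHypersurface

/-! ### Projective hypersurfaces and their holomorphic coordinates -/

/-- The hypersurface `{F = 0}` in `ℂPⁿ`. -/
def hypersurface {n : ℕ} (F : MvPolynomial (Fin (n + 1)) ℂ) : Set (ℙ ℂ (Fin (n + 1) → ℂ)) :=
  {p | ∀ (Z : Fin (n + 1) → ℂ) (hZ : Z ≠ 0),
    Projectivization.mk ℂ Z hZ = p → MvPolynomial.eval Z F = 0}

/-- `F` is a nonsingular equation: its partial derivatives have no common zero on `{F = 0}`. -/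
def IsNonsingular {n : ℕ} (F : MvPolynomial (Fin (n + 1)) ℂ) : Prop :=
  ∀ Z : Fin (n + 1) → ℂ, Z ≠ 0 → MvPolynomial.eval Z F = 0 →
    ∃ k, MvPolynomial.eval Z (MvPolynomial.pderiv k F) ≠ 0

/-- A local holomorphic coordinate system, with `m` coordinates `u = (u₁, …, u_m)`, on a subset
`M` of `ℂPⁿ`. It is given by its inverse
`u ↦ [lift u] = [Z₀(u) : ⋯ : Z_n(u)] ∈ M`, an injective holomorphic immersion of an open set of
`ℂᵐ`, together with homogeneous coordinates of the points. The kernel of the differential of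
`ℂⁿ⁺¹ ∖ 0 → ℂPⁿ` at `Z` is the line spanned by `Z`, so `immersion` says that the differential of
`u ↦ [lift u]` is injective. -/
structure HolomorphicCoordinates {n : ℕ} (M : Set (ℙ ℂ (Fin (n + 1) → ℂ))) (m : ℕ) where
  domain : Set (Fin m → ℂ)
  isOpen_domain : IsOpen domain
  lift : (Fin m → ℂ) → (Fin (n + 1) → ℂ)
  holomorphic : DifferentiableOn ℂ lift domain
  lift_ne_zero : ∀ u ∈ domain, lift u ≠ 0
  mem : ∀ u (hu : u ∈ domain), Projectivization.mk ℂ (lift u) (lift_ne_zero u hu) ∈ M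
  injective : ∀ u (hu : u ∈ domain) v (hv : v ∈ domain),
    Projectivization.mk ℂ (lift u) (lift_ne_zero u hu) =
      Projectivization.mk ℂ (lift v) (lift_ne_zero v hv) → u = v
  immersion : ∀ u ∈ domain, ∀ v, fderiv ℂ lift u v ∈ Submodule.span ℂ {lift u} → v = 0

/-! ### Wirtinger calculus and differential forms on `ℂᵐ` -/

variable {m : ℕ}

/-- `∂f/∂u_i`. -/
def wirtinger (i : Fin m) (f : (Fin m → ℂ) → ℂ) (u : Fin m → ℂ) : ℂ :=
  (fderiv ℝ f u (Pi.single i 1) - Complex.I * fderiv ℝ f u (Pi.single i Complex.I)) / 2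

/-- `∂f/∂ū_i`. -/
def wirtingerBar (i : Fin m) (f : (Fin m → ℂ) → ℂ) (u : Fin m → ℂ) : ℂ :=
  (fderiv ℝ f u (Pi.single i 1) + Complex.I * fderiv ℝ f u (Pi.single i Complex.I)) / 2

/-- The complex exterior algebra of the complexified real cotangent space of `ℂᵐ`: the values at
a point of complex differential forms. The product is the wedge product. -/
abbrev FormAt (m : ℕ) : Type := ExteriorAlgebra ℂ ((Fin m → ℂ) →L[ℝ] ℂ)

/-- `du_i`. -/
def du (i : Fin m) : FormAt m :=
  ExteriorAlgebra.ι ℂ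
    ((ContinuousLinearMap.proj i : (Fin m → ℂ) →L[ℂ] ℂ).restrictScalars ℝ)

/-- `dū_i`. -/
def duBar (i : Fin m) : FormAt m :=
  ExteriorAlgebra.ι ℂ
    ((Complex.conjCLE : ℂ →L[ℝ] ℂ).comp
      ((ContinuousLinearMap.proj i : (Fin m → ℂ) →L[ℂ] ℂ).restrictScalars ℝ))

/-- The `(1,1)`-form `(√-1/2π) ∑ A_{ij} du_i ∧ dū_j`. -/
def oneOneForm (A : Matrix (Fin m) (Fin m) ℂ) : FormAt m :=
  (Complex.I / (2 * (Real.pi : ℂ))) • ∑ i, ∑ j, A i j • (du i * duBar j)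

/-- `(√-1/2π) ∂∂̄ f` at `u`. -/
def ddbar (f : (Fin m → ℂ) → ℂ) (u : Fin m → ℂ) : FormAt m :=
  oneOneForm (Matrix.of fun i j => wirtinger i (wirtingerBar j f) u)

/-! ### Curvature of a Hermitian metric in coordinates -/

/-- For a Hermitian metric `g = (g_{k s̄})`, the function
`Γ_{ik}^ℓ = ∑_s (∂g_{k s̄}/∂u_i) g^{ℓ s̄}`, where `∑_s g_{k s̄} g^{ℓ s̄} = δ_{kℓ}`; thus
`g^{ℓ s̄}` is the `(s, ℓ)` entry of the inverse matrix. -/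
def christoffel (g : (Fin m → ℂ) → Matrix (Fin m) (Fin m) ℂ) (i k l : Fin m)
    (u : Fin m → ℂ) : ℂ :=
  ∑ s, wirtinger i (fun v => g v k s) u * (g u)⁻¹ s l

/-- The curvature coefficients `R_{k i j̄}^ℓ = -∂̄_j (∑_s (∂g_{k s̄}/∂u_i) g^{ℓ s̄})`. -/
def curvatureCoeff (g : (Fin m → ℂ) → Matrix (Fin m) (Fin m) ℂ) (k l i j : Fin m)
    (u : Fin m → ℂ) : ℂ :=
  -wirtingerBar j (christoffel g i k l) u

/-- The curvature matrix `Θ` of `(1,1)`-forms of the metric `g` on the holomorphic tangent bundle: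
its entry in row `k` and column `ℓ` is `Θ_k^ℓ = (√-1/2π) ∑ R_{k i j̄}^ℓ du_i ∧ dū_j`. -/
def curvatureMatrix (g : (Fin m → ℂ) → Matrix (Fin m) (Fin m) ℂ) (u : Fin m → ℂ) :
    Matrix (Fin m) (Fin m) (FormAt m) :=
  Matrix.of fun k l => oneOneForm (Matrix.of fun i j => curvatureCoeff g k l i j u)

/-! ### The Fubini-Study metric and the function `ξ` -/

/-- The Fubini-Study Hermitian form in homogeneous coordinates: for `V, W` tangent to `ℂⁿ⁺¹ ∖ 0`
at `Z`, the value on the images of `V, W` in the tangent space of `ℂPⁿ` at `[Z]`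
(see `fubiniStudy_affine`, `fubiniStudy_smul`). -/
def fubiniStudy {n : ℕ} (Z V W : Fin (n + 1) → ℂ) : ℂ :=
  (∑ k, V k * star (W k)) / (∑ k, Z k * star (Z k)) -
    (∑ k, V k * star (Z k)) * (∑ k, Z k * star (W k)) / (∑ k, Z k * star (Z k)) ^ 2

/-- `ξ = log (∑ |F_k|² / (∑ |Z_k|²)^{d-1})`, `F_k = ∂F/∂Z_k`, in homogeneous coordinates. -/
def xi {n : ℕ} (F : MvPolynomial (Fin (n + 1)) ℂ) (d : ℕ) (Z : Fin (n + 1) → ℂ) : ℝ :=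
  Real.log ((∑ k, ‖MvPolynomial.eval Z (MvPolynomial.pderiv k F)‖ ^ 2) /
    (∑ k, ‖Z k‖ ^ 2) ^ (d - 1))

namespace HolomorphicCoordinates

variable {n : ℕ} {M : Set (ℙ ℂ (Fin (n + 1) → ℂ))} (φ : HolomorphicCoordinates M m)

/-- The coefficients `g_{i j̄}` of the restriction to `M` of the Fubini-Study metric. -/
def metric (u : Fin m → ℂ) : Matrix (Fin m) (Fin m) ℂ :=
  Matrix.of fun i j =>
    fubiniStudy (φ.lift u) (fderiv ℂ φ.lift u (Pi.single i 1)) (fderiv ℂ φ.lift u (Pi.single j 1))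

/-- The form `ω = ω_FS|_M = (√-1/2π) ∑ g_{i j̄} du_i ∧ dū_j`. -/
def omega (u : Fin m → ℂ) : FormAt m := oneOneForm (φ.metric u)

/-- The curvature matrix of `(M, ω)`. -/
def curvature (u : Fin m → ℂ) : Matrix (Fin m) (Fin m) (FormAt m) := curvatureMatrix φ.metric u

/-- The form `(√-1/2π) ∂∂̄ξ` on `M`. -/
def ddbarXi (F : MvPolynomial (Fin (n + 1)) ℂ) (d : ℕ) (u : Fin m → ℂ) : FormAt m :=
  ddbar (fun v => ((xi F d (φ.lift v) : ℝ) : ℂ)) u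

end HolomorphicCoordinates

/-! ### The definitions do not depend on choices -/

/-- In the affine chart `Z₀ = 1`, with `z_i = Z_i/Z₀`, the Fubini-Study metric has coefficients
`δ_{ij}/(1+|z|²) - z̄_i z_j/(1+|z|²)²`. -/
theorem fubiniStudy_affine {n : ℕ} (z : Fin n → ℂ) (i j : Fin n) :
    fubiniStudy (Fin.cons 1 z : Fin (n + 1) → ℂ) (Fin.cons 0 (Pi.single i 1))
      (Fin.cons 0 (Pi.single j 1)) =
    (if i = j then 1 else 0) / (1 + ∑ k, z k * star (z k)) -
      star (z i) * z j / (1 + ∑ k, z k * star (z k)) ^ 2 := by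
  simp [fubiniStudy, Fin.sum_univ_succ, Pi.single_apply, eq_comm]

theorem sum_mul_star_ne_zero {n : ℕ} {Z : Fin (n + 1) → ℂ} (hZ : Z ≠ 0) :
    ∑ k, Z k * star (Z k) ≠ 0 := by
  intro h
  apply hZ
  have h' : ∑ k, Complex.normSq (Z k) = 0 := by
    have h1 : ((∑ k, Complex.normSq (Z k) : ℝ) : ℂ) = 0 := by
      rw [← h, Complex.ofReal_sum]
      exact Finset.sum_congr rfl fun k _ => (Complex.mul_conj (Z k)).symm
    exact_mod_cast h1
  funext k
  exact Complex.normSq_eq_zero.mp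
    ((Finset.sum_eq_zero_iff_of_nonneg fun k _ => Complex.normSq_nonneg (Z k)).mp h' k
      (Finset.mem_univ k))

/-- The Fubini-Study form descends to `ℂPⁿ`. -/
theorem fubiniStudy_smul {n : ℕ} (Z V W : Fin (n + 1) → ℂ) (hZ : Z ≠ 0) (c a b : ℂ)
    (hc : c ≠ 0) :
    fubiniStudy (c • Z) (c • V + a • Z) (c • W + b • Z) = fubiniStudy Z V W := by
  have hz := sum_mul_star_ne_zero hZ
  have hc' : star c ≠ 0 := star_ne_zero.mpr hc
  have e1 : ∑ k, (c • Z) k * star ((c • Z) k) = c * star c * ∑ k, Z k * star (Z k) := by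
    rw [Finset.mul_sum]
    refine Finset.sum_congr rfl fun k _ => ?_
    simp only [Pi.smul_apply, smul_eq_mul, star_mul']
    ring
  have e2 : ∑ k, (c • V + a • Z) k * star ((c • W + b • Z) k) =
      c * star c * (∑ k, V k * star (W k)) + c * star b * (∑ k, V k * star (Z k)) +
        a * star c * (∑ k, Z k * star (W k)) + a * star b * (∑ k, Z k * star (Z k)) := by
    simp only [Finset.mul_sum, ← Finset.sum_add_distrib]
    refine Finset.sum_congr rfl fun k _ => ?_
    simp only [Pi.add_apply, Pi.smul_apply, smul_eq_mul, star_mul', star_add]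
    ring
  have e3 : ∑ k, (c • V + a • Z) k * star ((c • Z) k) =
      c * star c * (∑ k, V k * star (Z k)) + a * star c * (∑ k, Z k * star (Z k)) := by
    simp only [Finset.mul_sum, ← Finset.sum_add_distrib]
    refine Finset.sum_congr rfl fun k _ => ?_
    simp only [Pi.add_apply, Pi.smul_apply, smul_eq_mul, star_mul']
    ring
  have e4 : ∑ k, (c • Z) k * star ((c • W + b • Z) k) =
      c * star c * (∑ k, Z k * star (W k)) + c * star b * (∑ k, Z k * star (Z k)) := by
    simp only [Finset.mul_sum, ← Finset.sum_add_distrib]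
    refine Finset.sum_congr rfl fun k _ => ?_
    simp only [Pi.add_apply, Pi.smul_apply, smul_eq_mul, star_mul', star_add]
    ring
  unfold fubiniStudy
  rw [e1, e2, e3, e4]
  generalize (∑ k, Z k * star (Z k)) = q at *
  generalize star c = c' at *
  field_simp
  ring

theorem eval_smul {n d : ℕ} {F : MvPolynomial (Fin (n + 1)) ℂ} (hF : F.IsHomogeneous d)
    (c : ℂ) (Z : Fin (n + 1) → ℂ) :
    MvPolynomial.eval (c • Z) F = c ^ d * MvPolynomial.eval Z F := by
  rw [MvPolynomial.eval_eq, MvPolynomial.eval_eq, Finset.mul_sum]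
  refine Finset.sum_congr rfl fun e he => ?_
  have h : ∏ i ∈ e.support, c ^ e i = c ^ d := by
    rw [Finset.prod_pow_eq_pow_sum, hF.degree_eq_sum_deg_support he]
  simp only [Pi.smul_apply, smul_eq_mul, mul_pow, Finset.prod_mul_distrib, h]
  ring

/-- `ξ` is a function on `M`. -/
theorem xi_smul {n d : ℕ} {F : MvPolynomial (Fin (n + 1)) ℂ} (hF : F.IsHomogeneous d)
    (Z : Fin (n + 1) → ℂ) (c : ℂ) (hc : c ≠ 0) : xi F d (c • Z) = xi F d Z := by
  have h : ∀ k, MvPolynomial.eval (c • Z) (MvPolynomial.pderiv k F) =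
      c ^ (d - 1) * MvPolynomial.eval Z (MvPolynomial.pderiv k F) :=
    fun k => eval_smul hF.pderiv c Z
  have hc' : (‖c‖ ^ (d - 1)) ^ 2 ≠ 0 := by positivity
  unfold xi
  simp only [h, Pi.smul_apply, smul_eq_mul, norm_mul, norm_pow, mul_pow, ← Finset.mul_sum]
  rw [pow_right_comm ‖c‖ 2 (d - 1), mul_div_mul_left _ _ hc']

theorem hasFDerivAt_eval {n : ℕ} (F : MvPolynomial (Fin (n + 1)) ℂ) (Z : Fin (n + 1) → ℂ) :
    HasFDerivAt (fun W : Fin (n + 1) → ℂ => MvPolynomial.eval W F)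
      (∑ k, MvPolynomial.eval Z (MvPolynomial.pderiv k F) •
        (ContinuousLinearMap.proj k : (Fin (n + 1) → ℂ) →L[ℂ] ℂ)) Z := by
  induction F using MvPolynomial.induction_on with
  | C a =>
    simp only [MvPolynomial.eval_C]
    refine (hasFDerivAt_const (𝕜 := ℂ) a Z).congr_fderiv ?_
    ext v
    simp
  | add p q hp hq =>
    simp only [map_add]
    refine (hp.add hq).congr_fderiv ?_
    ext v
    simp [add_mul, Finset.sum_add_distrib]
  | mul_X p i hp =>
    have hx : HasFDerivAt (fun W : Fin (n + 1) → ℂ => W i)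
        (ContinuousLinearMap.proj i : (Fin (n + 1) → ℂ) →L[ℂ] ℂ) Z :=
      (ContinuousLinearMap.proj i : (Fin (n + 1) → ℂ) →L[ℂ] ℂ).hasFDerivAt
    have := hp.mul hx
    simp only [map_mul, MvPolynomial.eval_X]
    refine this.congr_fderiv ?_
    ext v
    simp [MvPolynomial.pderiv_X, Pi.single_apply, add_mul, Finset.sum_add_distrib,
      Finset.mul_sum, mul_assoc, apply_ite]

/-- A nonsingular hypersurface is covered by its holomorphic coordinate systems. -/
theorem exists_holomorphicCoordinates {n d : ℕ} {F : MvPolynomial (Fin (n + 1)) ℂ}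
    (hF : F.IsHomogeneous d) (hs : IsNonsingular F) (p : ℙ ℂ (Fin (n + 1) → ℂ))
    (hp : p ∈ hypersurface F) :
    ∃ (φ : HolomorphicCoordinates (hypersurface F) (n - 1)) (u : Fin (n - 1) → ℂ)
      (hu : u ∈ φ.domain), Projectivization.mk ℂ (φ.lift u) (φ.lift_ne_zero u hu) = p := by
  have hZ0 : p.rep ≠ 0 := p.rep_nonzero
  have hFZ : MvPolynomial.eval p.rep F = 0 := hp _ hZ0 p.mk_rep
  set Z := p.rep with hZ
  obtain ⟨a, ha⟩ : ∃ a, Z a ≠ 0 := Function.ne_iff.mp hZ0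
  obtain ⟨b, hba, hb⟩ : ∃ b, b ≠ a ∧ MvPolynomial.eval Z (MvPolynomial.pderiv b F) ≠ 0 := by
    by_contra! hcon
    obtain ⟨k, hk⟩ := hs Z hZ0 hFZ
    have hka : k = a := by
      by_contra hka
      exact hk (hcon k hka)
    subst hka
    have h := congrArg (MvPolynomial.eval Z) hF.sum_X_mul_pderiv
    simp only [map_sum, map_mul, MvPolynomial.eval_X, map_nsmul, hFZ, smul_zero] at h
    rw [Finset.sum_eq_single k (fun j _ hj => by rw [hcon j hj, mul_zero])
      (fun h => absurd (Finset.mem_univ k) h)] at h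
    exact (mul_ne_zero ha hk) h
  let e : Fin (n - 1) ≃ {k : Fin (n + 1) // k ≠ a ∧ k ≠ b} :=
    (Fintype.equivFinOfCardEq (by
      rw [Fintype.card_subtype]
      have : (Finset.univ.filter fun k : Fin (n + 1) => k ≠ a ∧ k ≠ b) =
          (Finset.univ.erase a).erase b := by
        ext k; simp [and_comm]
      rw [this, Finset.card_erase_of_mem (by simp [hba]), Finset.card_erase_of_mem (by simp)]
      simp)).symm
  -- the local inverse of `W ↦ (W with its entry b replaced by F(W))`
  let G : (Fin (n + 1) → ℂ) → (Fin (n + 1) → ℂ) :=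
    fun W k => if k = b then MvPolynomial.eval W F else W k
  let L : (Fin (n + 1) → ℂ) →L[ℂ] (Fin (n + 1) → ℂ) :=
    ContinuousLinearMap.pi fun k => if k = b then
      (∑ k, MvPolynomial.eval Z (MvPolynomial.pderiv k F) •
        (ContinuousLinearMap.proj k : (Fin (n + 1) → ℂ) →L[ℂ] ℂ))
      else ContinuousLinearMap.proj k
  have hL : Function.Injective L := by
    rw [injective_iff_map_eq_zero]
    intro V hV
    have h1 : ∀ k, k ≠ b → V k = 0 := fun k hk => by
      have := congrFun hV k
      simpa [L, hk] using this
    have h2 := congrFun hV b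
    simp only [L, ContinuousLinearMap.coe_pi', if_true, Pi.zero_apply] at h2
    simp only [sum_apply, smul_apply,
      ContinuousLinearMap.proj_apply, smul_eq_mul] at h2
    rw [Finset.sum_eq_single b (fun j _ hj => by rw [h1 j hj, mul_zero])
      (fun h => absurd (Finset.mem_univ b) h)] at h2
    funext k
    by_cases hk : k = b
    · rw [hk]; exact (mul_eq_zero.mp h2).resolve_left hb
    · exact h1 k hk
  let L' : (Fin (n + 1) → ℂ) ≃L[ℂ] (Fin (n + 1) → ℂ) :=
    (LinearEquiv.ofInjectiveEndo (L : (Fin (n + 1) → ℂ) →ₗ[ℂ] _) hL).toContinuousLinearEquiv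
  have hL' : (L' : (Fin (n + 1) → ℂ) →L[ℂ] (Fin (n + 1) → ℂ)) = L := by
    ext v k; rfl
  have hGd : HasFDerivAt G (L' : (Fin (n + 1) → ℂ) →L[ℂ] (Fin (n + 1) → ℂ)) Z := by
    rw [hL', hasFDerivAt_pi]
    intro k
    by_cases hk : k = b
    · simpa [G, hk] using hasFDerivAt_eval F Z
    · have h := (ContinuousLinearMap.proj k : (Fin (n + 1) → ℂ) →L[ℂ] ℂ).hasFDerivAt (x := Z)
      simp only [hk, if_false]
      exact h
  have hGc : ContDiffAt ℂ 1 G Z := by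
    rw [contDiffAt_pi]
    intro k
    by_cases hk : k = b
    · simp only [G, hk, if_true]
      exact (AnalyticOnNhd.eval_mvPolynomial F Z (Set.mem_univ _)).contDiffAt
    · simp only [G, hk, if_false]
      exact contDiffAt_apply ℂ ℂ k Z
  have h10 : (1 : WithTop ℕ∞) ≠ 0 := one_ne_zero
  let ψ := hGc.localInverse hGd h10
  have hψZ : ψ (G Z) = Z := hGc.localInverse_apply_image hGd h10
  have hψc : ContDiffAt ℂ 1 ψ (G Z) := hGc.to_localInverse hGd h10
  have hψG : ∀ᶠ y in nhds (G Z), G (ψ y) = y :=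
    (hGc.hasStrictFDerivAt' hGd h10).eventually_right_inverse
  have hψd : ∀ᶠ y in nhds (G Z), DifferentiableAt ℂ ψ y :=
    (hψc.eventually (by simp)).mono fun y hy => hy.differentiableAt h10
  obtain ⟨O, hO, hOo, hOZ⟩ := eventually_nhds_iff.mp (hψG.and hψd)
  let y : (Fin (n - 1) → ℂ) → (Fin (n + 1) → ℂ) := fun u k =>
    if h : k ≠ a ∧ k ≠ b then u (e.symm ⟨k, h⟩) else if k = a then Z a else 0
  have hyd : Differentiable ℂ y := by
    rw [differentiable_pi]
    intro k
    by_cases h : k ≠ a ∧ k ≠ b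
    · have hy : (fun u => y u k) = fun u => u (e.symm ⟨k, h⟩) := by
        funext u
        exact dif_pos h
      rw [hy]
      fun_prop
    · have hy : (fun u => y u k) = fun _ => if k = a then Z a else 0 := by
        funext u
        exact dif_neg h
      rw [hy]
      exact differentiable_const _
  let u₀ : Fin (n - 1) → ℂ := fun i => Z (e i)
  have hy0 : y u₀ = G Z := by
    funext k
    by_cases hb' : k = b
    · simp [y, G, hb', hFZ, hba]
    · by_cases ha' : k = a
      · subst ha'
        simp [y, G, hb']
      · simp [y, G, u₀, hb', ha']
  have hGy : ∀ u, y u ∈ O → G (ψ (y u)) = y u := fun u hu => (hO _ hu).1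
  have hφa : ∀ u, y u ∈ O → ψ (y u) a = Z a := fun u hu => by
    have := congrFun (hGy u hu) a
    simpa [G, y, hba.symm] using this
  have hφb : ∀ u, y u ∈ O → MvPolynomial.eval (ψ (y u)) F = 0 := fun u hu => by
    have := congrFun (hGy u hu) b
    simpa [G, y, hba] using this
  have hφe : ∀ u, y u ∈ O → ∀ i, ψ (y u) (e i) = u i := fun u hu i => by
    have := congrFun (hGy u hu) (e i)
    simpa [G, y, (e i).2.1, (e i).2.2] using this
  have hne : ∀ u, y u ∈ O → ψ (y u) ≠ 0 := fun u hu h => ha (by rw [← hφa u hu, h]; rfl)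
  have hUo : IsOpen (y ⁻¹' O) := hOo.preimage hyd.continuous
  have hdiff : ∀ u, y u ∈ O → DifferentiableAt ℂ (fun u => ψ (y u)) u := fun u hu =>
    (hO _ hu).2.comp u (hyd u)
  refine ⟨{
    domain := y ⁻¹' O
    isOpen_domain := hUo
    lift := fun u => ψ (y u)
    holomorphic := fun u hu => (hdiff u hu).differentiableWithinAt
    lift_ne_zero := hne
    mem := ?_
    injective := ?_
    immersion := ?_ }, u₀, ?_, ?_⟩
  · intro u hu W hW hWu
    obtain ⟨c, hc⟩ := (Projectivization.mk_eq_mk_iff' ℂ _ _ _ _).mp hWu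
    rw [← hc, eval_smul hF, hφb u hu, mul_zero]
  · intro u hu v hv huv
    obtain ⟨c, hc⟩ := (Projectivization.mk_eq_mk_iff' ℂ _ _ _ _).mp huv
    have h1 := congrFun hc a
    simp only [Pi.smul_apply, smul_eq_mul, hφa u hu, hφa v hv] at h1
    have hc1 : c = 1 := mul_right_cancel₀ ha (by rw [h1, one_mul])
    rw [hc1, one_smul] at hc
    funext i
    rw [← hφe u hu i, ← hφe v hv i, hc]
  · intro u hu v hv
    obtain ⟨c, hc⟩ := Submodule.mem_span_singleton.mp hv
    have hcomp : ∀ k, HasFDerivAt (fun u => ψ (y u) k)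
        ((ContinuousLinearMap.proj k).comp (fderiv ℂ (fun u => ψ (y u)) u)) u := fun k =>
      hasFDerivAt_pi'.mp (hdiff u hu).hasFDerivAt k
    have hnhds : ∀ᶠ w in nhds u, y w ∈ O := hUo.mem_nhds hu
    have hda : fderiv ℂ (fun u => ψ (y u)) u v a = 0 := by
      have h := ((hasFDerivAt_const (Z a) u).congr_of_eventuallyEq
        (hnhds.mono fun w hw => hφa w hw)).unique (hcomp a)
      simpa using (congrArg (fun T : (Fin (n - 1) → ℂ) →L[ℂ] ℂ => T v) h).symm
    have hc0 : c = 0 := by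
      have h1 := congrFun hc a
      rw [hda, Pi.smul_apply, smul_eq_mul, hφa u hu] at h1
      exact (mul_eq_zero.mp h1).resolve_right ha
    rw [hc0, zero_smul] at hc
    funext i
    have h := (((ContinuousLinearMap.proj i : (Fin (n - 1) → ℂ) →L[ℂ] ℂ).hasFDerivAt
      (x := u)).congr_of_eventuallyEq
        (hnhds.mono fun w hw => hφe w hw i)).unique (hcomp (e i))
    have h' := congrArg (fun T : (Fin (n - 1) → ℂ) →L[ℂ] ℂ => T v) h
    simpa [← hc] using h'
  · change y u₀ ∈ O
    rw [hy0]; exact hOZ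
  · have : ψ (y u₀) = Z := by rw [hy0, hψZ]
    simp only [this]
    exact p.mk_rep

end ProjHypersurface

end

open ProjHypersurface

/-!
The moving frame method of classical hypersurface geometry, in homogeneous coordinates. Let `Z(u)`
be the holomorphic lift of the coordinates `u ∈ ℂᵐ`, `m = n - 1`, and `ν(u) = (F_0, …, F_n)(Z(u))`
the gradient along it. Euler's identity and `F(Z(u)) = 0` say that the linear form `ν` vanishes on
`Z` and on all `∂_i Z`. Hence `(∂₁Z, …, ∂_m Z, Z, ν̄)` is a frame of `ℂⁿ⁺¹`, all of whose members but `ν̄` are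
holomorphic.

The decomposition of `∂_i∂_k Z` in this frame (`ConormalPatch.secondDeriv_eq`) has as its
coefficients the Christoffel symbols, the functions `∂_i log |Z|²`, and the second fundamental form
`s_{ik} = ν(∂_i∂_k Z)/|ν|²`. Applying `∂̄_j`, which kills the left-hand side, and decomposing
`∂̄_j ν̄` in the frame, with components `t_{jℓ}` along `∂_ℓ Z`, gives the Gauss equation
`R_{k i j̄}^ℓ = g_{k j̄} δ_{iℓ} + g_{i j̄} δ_{kℓ} + s_{ik} t_{jℓ}`, and the same decomposition gives
`∂∂̄ log |ν|² = -∑_ℓ s_{iℓ} t_{jℓ}` (`ConormalPatch.exists_gauss_equation`).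

So `Θ = ω + A + B` with `A_k^ℓ = x_ℓ ∧ β_k` and `B_k^ℓ = h_k ∧ t_ℓ` of rank one. The symmetry of `s`
and of `t g` gives `AB = BA = 0`, and anticommutation gives `A² = -ωA`, `B² = -τB`, where
`ω = tr A` and `τ = tr B`. Therefore `tr Θʲ = (m + 2) ωʲ - (ω - τ)ʲ` (`trace_pow_of_mul_self`). Since
`∂∂̄ξ = ∂∂̄ log |ν|² - (d - 1) ∂∂̄ log |Z|²` stands for `-τ - (d - 1) ω`, the form `ω - τ` is
`d ω + (√-1/2π) ∂∂̄ξ`, and `m + 2 = n + 1`.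

The argument differentiates `Z` three times, while a coordinate system is only assumed to be complex
differentiable; `differentiableAt_fderiv_apply` supplies the regularity.
-/

noncomputable section

namespace ProjHypersurface

/-! ### Derivatives of holomorphic maps of several variables -/

/-- A complex differentiable map on an open subset of `ℂᵐ` has complex differentiable directional
derivatives: Cauchy's formula on a small circle in the direction `v` writes the derivative as an
integral, which may be differentiated under the integral sign because the Schwarz lemma bounds
`fderiv ℂ f` locally. -/
theorem differentiableAt_fderiv_apply {m N : ℕ} {U : Set (Fin m → ℂ)} (hU : IsOpen U)
    {f : (Fin m → ℂ) → (Fin N → ℂ)} (hf : DifferentiableOn ℂ f U) {u₀ : Fin m → ℂ}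
    (hu₀ : u₀ ∈ U) (v : Fin m → ℂ) :
    DifferentiableAt ℂ (fun u => fderiv ℂ f u v) u₀ := by
  have hev : ∀ᶠ w in nhds u₀, w ∈ U ∧ dist (f w) (f u₀) < 1 :=
    (hU.eventually_mem hu₀).and
      ((hf.differentiableAt (hU.mem_nhds hu₀)).continuousAt.eventually
        (Metric.ball_mem_nhds _ one_pos))
  obtain ⟨δ, hδ, hball⟩ := Metric.eventually_nhds_iff_ball.mp hev
  have hfd : ∀ w ∈ Metric.ball u₀ δ, DifferentiableAt ℂ f w := fun w hw =>
    hf.differentiableAt (hU.mem_nhds (hball w hw).1)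
  have hbound : ∀ w ∈ Metric.ball u₀ (δ / 2), ‖fderiv ℂ f w‖ ≤ 2 / (δ / 2) := by
    intro w hw
    have hsub : Metric.ball w (δ / 2) ⊆ Metric.ball u₀ δ :=
      Metric.ball_subset_ball' (by rw [Metric.mem_ball] at hw; linarith)
    refine Complex.norm_fderiv_le_div_of_mapsTo_ball
      (fun x hx => (hfd x (hsub hx)).differentiableWithinAt) (fun x hx => ?_) (by positivity)
    have h1 := (hball x (hsub hx)).2
    have h2 := (hball w (Metric.ball_subset_ball (by linarith) hw)).2
    rw [Metric.mem_closedBall]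
    linarith [dist_triangle_right (f x) (f w) (f u₀)]
  set r : ℝ := δ / (4 * (‖v‖ + 1)) with hr
  have hrpos : 0 < r := by positivity
  have hrv : r * ‖v‖ ≤ δ / 4 := by
    rw [hr, div_mul_eq_mul_div, div_le_div_iff₀ (by positivity) (by positivity)]
    nlinarith [norm_nonneg v]
  have hmem : ∀ u ∈ Metric.ball u₀ (δ / 4), ∀ ζ : ℂ, ‖ζ‖ ≤ r →
      u + ζ • v ∈ Metric.ball u₀ (δ / 2) := by
    intro u hu ζ hζ
    rw [Metric.mem_ball, dist_eq_norm] at hu ⊢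
    have h1 : ‖ζ • v‖ ≤ δ / 4 := by
      rw [norm_smul]
      exact (mul_le_mul_of_nonneg_right hζ (norm_nonneg v)).trans hrv
    calc ‖u + ζ • v - u₀‖ = ‖(u - u₀) + ζ • v‖ := by congr 1; abel
      _ ≤ ‖u - u₀‖ + ‖ζ • v‖ := norm_add_le _ _
      _ < δ / 2 := by linarith
  have hhalf : Metric.ball u₀ (δ / 2) ⊆ Metric.ball u₀ δ :=
    Metric.ball_subset_ball (by linarith)
  have hcm : ∀ θ : ℝ, ‖circleMap 0 r θ‖ ≤ r := fun θ => by
    simp [abs_of_pos hrpos]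
  let k : ℝ → ℂ := fun θ => deriv (circleMap 0 r) θ * ((circleMap 0 r θ - 0) ^ 2)⁻¹
  have hk : Continuous k := by
    have h0 : ∀ θ, circleMap 0 r θ ≠ 0 := fun θ => circleMap_ne_center hrpos.ne'
    simp only [k, deriv_circleMap, sub_zero]
    fun_prop (disch := simpa using h0)
  have hformula : ∀ u ∈ Metric.ball u₀ (δ / 4), fderiv ℂ f u v =
      (2 * Real.pi * Complex.I : ℂ)⁻¹ •
        ∫ θ in (0 : ℝ)..2 * Real.pi, k θ • f (u + circleMap 0 r θ • v) := by
    intro u hu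
    have hO : IsOpen {ζ : ℂ | u + ζ • v ∈ Metric.ball u₀ (δ / 2)} :=
      Metric.isOpen_ball.preimage (by fun_prop)
    have h1 := Complex.two_pi_I_inv_smul_circleIntegral_sub_sq_inv_smul_of_differentiable
      (f := fun ζ : ℂ => f (u + ζ • v)) hO (c := 0) (R := r) (w₀ := 0)
      (fun ζ hζ => hmem u hu ζ (by simpa using hζ))
      (fun ζ hζ => ((hfd _ (hhalf hζ)).comp ζ (by fun_prop)).differentiableWithinAt)
      (by simpa using hrpos)
    have h2 : HasDerivAt (fun ζ : ℂ => f (u + ζ • v)) (fderiv ℂ f u v) 0 := by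
      have hu' : u ∈ Metric.ball u₀ δ := Metric.ball_subset_ball (by linarith) hu
      have h3 : HasDerivAt (fun ζ : ℂ => u + ζ • v) v 0 := by
        simpa using ((hasDerivAt_id (0 : ℂ)).smul_const v).const_add u
      have h4 : HasFDerivAt f (fderiv ℂ f u) (u + (0 : ℂ) • v) := by
        simpa using (hfd u hu').hasFDerivAt
      exact h4.comp_hasDerivAt (0 : ℂ) h3
    rw [h2.deriv] at h1
    rw [← h1]
    simp only [circleIntegral, k, smul_smul]
  have hcont : ∀ u ∈ Metric.ball u₀ (δ / 4),
      Continuous fun θ : ℝ => k θ • f (u + circleMap 0 r θ • v) := fun u hu =>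
    hk.smul (continuous_iff_continuousAt.mpr fun θ =>
      (hfd _ (hhalf (hmem u hu _ (hcm θ)))).continuousAt.comp
        (f := fun θ => u + circleMap 0 r θ • v) (by fun_prop))
  have hquarter : Metric.ball u₀ (δ / 4) ∈ nhds u₀ := Metric.ball_mem_nhds _ (by positivity)
  have : ProperSpace ((Fin m → ℂ) →L[ℂ] (Fin N → ℂ)) := FiniteDimensional.proper ℂ _
  have key := intervalIntegral.hasFDerivAt_integral_of_dominated_of_fderiv_le (𝕜 := ℂ)
    (μ := MeasureTheory.volume) (a := 0) (b := 2 * Real.pi) (s := Metric.ball u₀ (δ / 4))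
    (F := fun u θ => k θ • f (u + circleMap 0 r θ • v))
    (F' := fun u θ => k θ • fderiv ℂ f (u + circleMap 0 r θ • v)) (x₀ := u₀)
    (bound := fun θ => ‖k θ‖ * (2 / (δ / 2))) hquarter
    (Filter.eventually_of_mem hquarter fun u hu => (hcont u hu).aestronglyMeasurable)
    ((hcont u₀ (Metric.mem_ball_self (by positivity))).intervalIntegrable _ _)
    (hk.aestronglyMeasurable.smul
      ((measurable_fderiv ℂ f).comp
        (by fun_prop : Continuous fun θ : ℝ =>
          u₀ + circleMap 0 r θ • v).measurable).aestronglyMeasurable)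
    (Filter.Eventually.of_forall fun θ _ u hu => by
      rw [norm_smul]
      exact mul_le_mul_of_nonneg_left (hbound _ (hmem u hu _ (hcm θ))) (norm_nonneg _))
    ((hk.norm.mul continuous_const).intervalIntegrable _ _)
    (Filter.Eventually.of_forall fun θ _ u hu => by
      have h1 := (hfd _ (hhalf (hmem u hu _ (hcm θ)))).hasFDerivAt
      have h2 : HasFDerivAt (fun u => u + circleMap 0 r θ • v)
          (ContinuousLinearMap.id ℂ (Fin m → ℂ)) u := (hasFDerivAt_id u).add_const _
      have h3 := (h1.comp u h2).const_smul (k θ)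
      simpa using h3)
  exact (key.differentiableAt.const_smul (2 * Real.pi * Complex.I : ℂ)⁻¹).congr_of_eventuallyEq
    (Filter.eventually_of_mem hquarter hformula)

/-! ### Wirtinger calculus -/

/-- `f` is real differentiable at `u`, with `∂f/∂u_i = a i` and `∂f/∂ū_i = b i`. -/
structure HasWirtingerAt {m : ℕ} (f : (Fin m → ℂ) → ℂ) (a b : Fin m → ℂ) (u : Fin m → ℂ) :
    Prop where
  differentiableAt : DifferentiableAt ℝ f u
  wirtinger_eq : ∀ i, wirtinger i f u = a i
  wirtingerBar_eq : ∀ i, wirtingerBar i f u = b i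

theorem _root_.Filter.EventuallyEq.wirtinger_eq {m : ℕ} {f g : (Fin m → ℂ) → ℂ} {u : Fin m → ℂ}
    (h : f =ᶠ[nhds u] g) (i : Fin m) : wirtinger i f u = wirtinger i g u := by
  simp only [wirtinger, h.fderiv_eq]

theorem _root_.Filter.EventuallyEq.wirtingerBar_eq {m : ℕ} {f g : (Fin m → ℂ) → ℂ}
    {u : Fin m → ℂ} (h : f =ᶠ[nhds u] g) (i : Fin m) :
    wirtingerBar i f u = wirtingerBar i g u := by
  simp only [wirtingerBar, h.fderiv_eq]

theorem _root_.DifferentiableAt.hasWirtingerAt {m : ℕ} {f : (Fin m → ℂ) → ℂ} {u : Fin m → ℂ}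
    (hf : DifferentiableAt ℝ f u) :
    HasWirtingerAt f (fun i => wirtinger i f u) (fun i => wirtingerBar i f u) u :=
  ⟨hf, fun _ => rfl, fun _ => rfl⟩

namespace HasWirtingerAt

variable {m : ℕ} {f g : (Fin m → ℂ) → ℂ} {a b a' b' : Fin m → ℂ} {u : Fin m → ℂ}

theorem const (c : ℂ) (u : Fin m → ℂ) : HasWirtingerAt (fun _ => c) 0 0 u :=
  ⟨differentiableAt_const _, fun i => by simp [wirtinger], fun i => by simp [wirtingerBar]⟩

theorem add (hf : HasWirtingerAt f a b u) (hg : HasWirtingerAt g a' b' u) :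
    HasWirtingerAt (fun v => f v + g v) (fun i => a i + a' i) (fun i => b i + b' i) u := by
  refine ⟨hf.1.add hg.1, fun i => ?_, fun i => ?_⟩
  · rw [← hf.2, ← hg.2]
    simp only [wirtinger, fderiv_fun_add hf.1 hg.1, add_apply]
    ring
  · rw [← hf.3, ← hg.3]
    simp only [wirtingerBar, fderiv_fun_add hf.1 hg.1, add_apply]
    ring

theorem mul (hf : HasWirtingerAt f a b u) (hg : HasWirtingerAt g a' b' u) :
    HasWirtingerAt (fun v => f v * g v) (fun i => a i * g u + f u * a' i)
      (fun i => b i * g u + f u * b' i) u := by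
  refine ⟨hf.1.mul hg.1, fun i => ?_, fun i => ?_⟩
  · rw [← hf.2, ← hg.2]
    simp only [wirtinger, fderiv_fun_mul hf.1 hg.1, add_apply,
      smul_apply, smul_eq_mul]
    ring
  · rw [← hf.3, ← hg.3]
    simp only [wirtingerBar, fderiv_fun_mul hf.1 hg.1, add_apply,
      smul_apply, smul_eq_mul]
    ring

theorem sub (hf : HasWirtingerAt f a b u) (hg : HasWirtingerAt g a' b' u) :
    HasWirtingerAt (fun v => f v - g v) (fun i => a i - a' i) (fun i => b i - b' i) u := by
  simpa [sub_eq_add_neg] using hf.add ((const (-1) u).mul hg)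

theorem sum {ι : Type*} {s : Finset ι} {f : ι → (Fin m → ℂ) → ℂ} {a b : ι → Fin m → ℂ}
    (h : ∀ k ∈ s, HasWirtingerAt (f k) (a k) (b k) u) :
    HasWirtingerAt (fun v => ∑ k ∈ s, f k v) (fun i => ∑ k ∈ s, a k i)
      (fun i => ∑ k ∈ s, b k i) u := by
  classical
  induction s using Finset.induction_on with
  | empty =>
    simp only [Finset.sum_empty]
    exact const 0 u
  | insert k s hk ih =>
    simp only [Finset.sum_insert hk]
    exact (h k (Finset.mem_insert_self k s)).add
      (ih fun l hl => h l (Finset.mem_insert_of_mem hl))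

theorem inv (hf : HasWirtingerAt f a b u) (h0 : f u ≠ 0) :
    HasWirtingerAt (fun v => (f v)⁻¹) (fun i => -a i / f u ^ 2) (fun i => -b i / f u ^ 2) u := by
  have h := (hasDerivAt_inv h0).hasFDerivAt.restrictScalars ℝ |>.comp u hf.1.hasFDerivAt
  have h' : HasFDerivAt (fun v => (f v)⁻¹) _ u := h
  refine ⟨h'.differentiableAt, fun i => ?_, fun i => ?_⟩
  · rw [← hf.2]
    simp only [wirtinger, h'.fderiv, ContinuousLinearMap.comp_apply,
      ContinuousLinearMap.coe_restrictScalars', ContinuousLinearMap.toSpanSingleton_apply,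
      smul_eq_mul]
    ring
  · rw [← hf.3]
    simp only [wirtingerBar, h'.fderiv, ContinuousLinearMap.comp_apply,
      ContinuousLinearMap.coe_restrictScalars', ContinuousLinearMap.toSpanSingleton_apply,
      smul_eq_mul]
    ring

theorem div (hf : HasWirtingerAt f a b u) (hg : HasWirtingerAt g a' b' u) (h0 : g u ≠ 0) :
    HasWirtingerAt (fun v => f v / g v) (fun i => a i / g u - f u * a' i / g u ^ 2)
      (fun i => b i / g u - f u * b' i / g u ^ 2) u := by
  have h := hf.mul (hg.inv h0)
  refine ⟨by simpa only [div_eq_mul_inv] using h.1, fun i => ?_, fun i => ?_⟩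
  · simp only [div_eq_mul_inv] at h ⊢
    rw [h.2]
    ring
  · simp only [div_eq_mul_inv] at h ⊢
    rw [h.3]
    ring

theorem star (hf : HasWirtingerAt f a b u) :
    HasWirtingerAt (fun v => star (f v)) (fun i => star (b i)) (fun i => star (a i)) u := by
  have h : HasFDerivAt (fun v => (starRingEnd ℂ) (f v)) _ u :=
    (Complex.conjCLE : ℂ →L[ℝ] ℂ).hasFDerivAt.comp u hf.1.hasFDerivAt
  refine ⟨h.differentiableAt, fun i => ?_, fun i => ?_⟩
  · rw [← hf.3]
    simp only [wirtinger, wirtingerBar, starRingEnd_apply] at h ⊢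
    rw [h.fderiv]
    simp [sub_eq_add_neg]
  · rw [← hf.2]
    simp only [wirtinger, wirtingerBar, starRingEnd_apply] at h ⊢
    rw [h.fderiv]
    simp

theorem of_holomorphic (hf : DifferentiableAt ℂ f u) :
    HasWirtingerAt f (fun i => fderiv ℂ f u (Pi.single i 1)) 0 u := by
  have h := hf.hasFDerivAt.restrictScalars ℝ
  have hI : ∀ i : Fin m, (Pi.single i Complex.I : Fin m → ℂ) =
      Complex.I • (Pi.single i 1 : Fin m → ℂ) := fun i => by
    rw [← Pi.single_smul]; simp
  refine ⟨h.differentiableAt, fun i => ?_, fun i => ?_⟩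
  · simp only [wirtinger, h.fderiv, ContinuousLinearMap.coe_restrictScalars', hI, map_smul,
      smul_eq_mul, ← mul_assoc, Complex.I_mul_I]
    ring
  · simp only [wirtingerBar, h.fderiv, ContinuousLinearMap.coe_restrictScalars', hI, map_smul,
      smul_eq_mul, ← mul_assoc, Complex.I_mul_I, Pi.zero_apply]
    ring

theorem log {q : (Fin m → ℂ) → ℝ} (hq : HasWirtingerAt (fun v => (q v : ℂ)) a b u)
    (h0 : q u ≠ 0) :
    HasWirtingerAt (fun v => ((Real.log (q v) : ℝ) : ℂ)) (fun i => a i / q u)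
      (fun i => b i / q u) u := by
  have hqd : DifferentiableAt ℝ q u :=
    (Complex.reCLM.hasFDerivAt.comp u hq.1.hasFDerivAt).differentiableAt
  have h1 : HasFDerivAt (fun v => (q v : ℂ)) _ u :=
    Complex.ofRealCLM.hasFDerivAt.comp u hqd.hasFDerivAt
  have h2 : HasFDerivAt (fun v => ((Real.log (q v) : ℝ) : ℂ)) _ u :=
    Complex.ofRealCLM.hasFDerivAt.comp u (hqd.hasFDerivAt.log h0)
  refine ⟨h2.differentiableAt, fun i => ?_, fun i => ?_⟩
  · rw [← hq.2]
    simp only [wirtinger, h1.fderiv, h2.fderiv, ContinuousLinearMap.comp_apply, smul_apply,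
      Complex.ofRealCLM_apply, smul_eq_mul, Complex.ofReal_mul, Complex.ofReal_inv]
    ring
  · rw [← hq.3]
    simp only [wirtingerBar, h1.fderiv, h2.fderiv, ContinuousLinearMap.comp_apply, smul_apply,
      Complex.ofRealCLM_apply, smul_eq_mul, Complex.ofReal_mul, Complex.ofReal_inv]
    ring

end HasWirtingerAt

/-! ### Holomorphic vector-valued functions -/

/-- The complex partial derivative `∂Y/∂u_i` of a vector-valued function. -/
def partialDeriv {m N : ℕ} (i : Fin m) (Y : (Fin m → ℂ) → (Fin N → ℂ)) (u : Fin m → ℂ) :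
    Fin N → ℂ :=
  fderiv ℂ Y u (Pi.single i 1)

theorem differentiableOn_partialDeriv {m N : ℕ} {U : Set (Fin m → ℂ)} (hU : IsOpen U)
    {Y : (Fin m → ℂ) → (Fin N → ℂ)} (hY : DifferentiableOn ℂ Y U) (i : Fin m) :
    DifferentiableOn ℂ (partialDeriv i Y) U := fun _ hu =>
  (differentiableAt_fderiv_apply hU hY hu _).differentiableWithinAt

theorem partialDeriv_comm {m N : ℕ} {U : Set (Fin m → ℂ)} (hU : IsOpen U)
    {Y : (Fin m → ℂ) → (Fin N → ℂ)} (hY : DifferentiableOn ℂ Y U) {u : Fin m → ℂ} (hu : u ∈ U)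
    (i k : Fin m) : partialDeriv i (partialDeriv k Y) u = partialDeriv k (partialDeriv i Y) u := by
  have hd : DifferentiableAt ℂ (fderiv ℂ Y) u := by
    have hsum : fderiv ℂ Y = fun x => ∑ l, ContinuousLinearMap.smulRightL ℂ (Fin m → ℂ) (Fin N → ℂ)
        (ContinuousLinearMap.proj l) (fderiv ℂ Y x (Pi.single l 1)) := by
      funext x
      ext1 v
      conv_lhs => rw [← Finset.univ_sum_single v]
      simp only [map_sum, sum_apply, ContinuousLinearMap.smulRightL_apply_apply,
        ContinuousLinearMap.smulRight_apply, ContinuousLinearMap.proj_apply, ← map_smul]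
      refine Finset.sum_congr rfl fun l _ => ?_
      rw [← Pi.single_smul, smul_eq_mul, mul_one]
    rw [hsum]
    exact DifferentiableAt.fun_sum fun l _ => (ContinuousLinearMap.differentiableAt _).comp u
      (differentiableAt_fderiv_apply hU hY hu _)
  have happ : ∀ v w, fderiv ℂ (fun x => fderiv ℂ Y x v) u w = fderiv ℂ (fderiv ℂ Y) u w v :=
    fun v w => by rw [fderiv_clm_apply hd (differentiableAt_const v)]; simp
  have hsymm := second_derivative_symmetric_of_eventually (𝕜 := ℂ)
    ((hU.eventually_mem hu).mono fun v hv =>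
      (hY.differentiableAt (hU.mem_nhds hv)).hasFDerivAt) hd.hasFDerivAt
  unfold partialDeriv
  rw [happ, happ, hsymm]

theorem hasWirtingerAt_apply {m N : ℕ} {Y : (Fin m → ℂ) → (Fin N → ℂ)} {u : Fin m → ℂ}
    (hY : DifferentiableAt ℂ Y u) (k : Fin N) :
    HasWirtingerAt (fun v => Y v k) (fun i => partialDeriv i Y u k) 0 u := by
  have h := HasWirtingerAt.of_holomorphic (differentiableAt_pi.mp hY k)
  rwa [fderiv_apply hY] at h

open scoped Matrix in
theorem hasWirtingerAt_dotProduct {m N : ℕ} {X Y : (Fin m → ℂ) → (Fin N → ℂ)} {u : Fin m → ℂ}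
    (hX : DifferentiableAt ℂ X u) (hY : DifferentiableAt ℂ Y u) :
    HasWirtingerAt (fun v => X v ⬝ᵥ Y v)
      (fun i => partialDeriv i X u ⬝ᵥ Y u + X u ⬝ᵥ partialDeriv i Y u) 0 u := by
  have h := HasWirtingerAt.sum (s := Finset.univ) fun k _ =>
    (hasWirtingerAt_apply hX k).mul (hasWirtingerAt_apply hY k)
  simpa [dotProduct, Finset.sum_add_distrib] using! h

open scoped Matrix in
theorem hasWirtingerAt_dotProduct_star {m N : ℕ} {X Y : (Fin m → ℂ) → (Fin N → ℂ)}
    {u : Fin m → ℂ} (hX : DifferentiableAt ℂ X u) (hY : DifferentiableAt ℂ Y u) :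
    HasWirtingerAt (fun v => X v ⬝ᵥ star (Y v)) (fun i => partialDeriv i X u ⬝ᵥ star (Y u))
      (fun i => X u ⬝ᵥ star (partialDeriv i Y u)) u := by
  have h := HasWirtingerAt.sum (s := Finset.univ) fun k _ =>
    (hasWirtingerAt_apply hX k).mul (hasWirtingerAt_apply hY k).star
  simpa [dotProduct] using h

/-! ### The Fubini-Study form of a moving point -/

open scoped Matrix

theorem dotProduct_star_self_eq_ofReal {N : ℕ} (Z : Fin N → ℂ) :
    Z ⬝ᵥ star Z = ((∑ k, ‖Z k‖ ^ 2 : ℝ) : ℂ) := by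
  simp [dotProduct, Complex.mul_conj']

theorem sum_norm_sq_ne_zero {N : ℕ} {Z : Fin N → ℂ} (hZ : Z ≠ 0) : ∑ k, ‖Z k‖ ^ 2 ≠ 0 := by
  intro h
  refine hZ (funext fun k => ?_)
  have := (Finset.sum_eq_zero_iff_of_nonneg fun k _ => sq_nonneg ‖Z k‖).mp h k (Finset.mem_univ k)
  simpa using this

theorem dotProduct_star_self_ne_zero {N : ℕ} {Z : Fin N → ℂ} (hZ : Z ≠ 0) : Z ⬝ᵥ star Z ≠ 0 := by
  rw [dotProduct_star_self_eq_ofReal]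
  exact_mod_cast sum_norm_sq_ne_zero hZ

theorem star_dotProduct_comm {N : ℕ} (V W : Fin N → ℂ) :
    star (V ⬝ᵥ star W) = W ⬝ᵥ star V := by
  rw [← Matrix.star_dotProduct_star, star_star, dotProduct_comm]

/-- The Fubini-Study form as a linear function of its first argument. -/
def fubiniStudyLeft {n : ℕ} (Z W : Fin (n + 1) → ℂ) : (Fin (n + 1) → ℂ) →ₗ[ℂ] ℂ where
  toFun V := fubiniStudy Z V W
  map_add' V V' := by
    change (V + V') ⬝ᵥ star W / _ - (V + V') ⬝ᵥ star Z * _ / _ =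
      (V ⬝ᵥ star W / _ - V ⬝ᵥ star Z * _ / _) + (V' ⬝ᵥ star W / _ - V' ⬝ᵥ star Z * _ / _)
    rw [add_dotProduct, add_dotProduct]
    ring
  map_smul' c V := by
    change (c • V) ⬝ᵥ star W / _ - (c • V) ⬝ᵥ star Z * _ / _ =
      c * (V ⬝ᵥ star W / _ - V ⬝ᵥ star Z * _ / _)
    rw [smul_dotProduct, smul_dotProduct, smul_eq_mul, smul_eq_mul]
    ring

theorem fubiniStudyLeft_apply {n : ℕ} (Z V W : Fin (n + 1) → ℂ) :
    fubiniStudyLeft Z W V =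
      V ⬝ᵥ star W / (Z ⬝ᵥ star Z) - V ⬝ᵥ star Z * Z ⬝ᵥ star W / (Z ⬝ᵥ star Z) ^ 2 := rfl

theorem fubiniStudyLeft_self {n : ℕ} {Z : Fin (n + 1) → ℂ} (hZ : Z ≠ 0) (W : Fin (n + 1) → ℂ) :
    fubiniStudyLeft Z W Z = 0 := by
  have := dotProduct_star_self_ne_zero hZ
  rw [fubiniStudyLeft_apply]
  field_simp
  ring

section Calculus

variable {m n : ℕ} {u : Fin m → ℂ}

theorem _root_.DifferentiableAt.dotProduct_star {N : ℕ} {X Y : (Fin m → ℂ) → (Fin N → ℂ)}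
    (hX : DifferentiableAt ℝ X u) (hY : DifferentiableAt ℝ Y u) :
    DifferentiableAt ℝ (fun v => X v ⬝ᵥ star (Y v)) u :=
  DifferentiableAt.fun_sum fun k _ =>
    (differentiableAt_pi.mp hX k).mul (differentiableAt_pi.mp hY k).star

theorem _root_.DifferentiableAt.fubiniStudyLeft {Y V W : (Fin m → ℂ) → (Fin (n + 1) → ℂ)}
    (hY : DifferentiableAt ℝ Y u) (hV : DifferentiableAt ℝ V u) (hW : DifferentiableAt ℝ W u)
    (h0 : Y u ≠ 0) :
    DifferentiableAt ℝ (fun v => fubiniStudyLeft (Y v) (W v) (V v)) u := by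
  have hq := dotProduct_star_self_ne_zero h0
  simp only [fubiniStudyLeft_apply]
  exact (((hV.dotProduct_star hW).hasWirtingerAt.div (hY.dotProduct_star hY).hasWirtingerAt
    hq).sub (((hV.dotProduct_star hY).mul (hY.dotProduct_star hW)).hasWirtingerAt.div
      ((hY.dotProduct_star hY).pow 2).hasWirtingerAt (pow_ne_zero 2 hq))).1

/-- The function `⟨∂_i Y, Y⟩ / ⟨Y, Y⟩ = ∂_i log ⟨Y, Y⟩`. -/
def logDeriv {m N : ℕ} (Y : (Fin m → ℂ) → (Fin N → ℂ)) (i : Fin m) (u : Fin m → ℂ) : ℂ :=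
  partialDeriv i Y u ⬝ᵥ star (Y u) / (Y u ⬝ᵥ star (Y u))

theorem differentiableAt_logDeriv {U : Set (Fin m → ℂ)} (hU : IsOpen U)
    {Y : (Fin m → ℂ) → (Fin (n + 1) → ℂ)} (hY : DifferentiableOn ℂ Y U) (hu : u ∈ U)
    (h0 : Y u ≠ 0) (i : Fin m) : DifferentiableAt ℝ (logDeriv Y i) u := by
  have h1 := (hY.differentiableAt (hU.mem_nhds hu)).restrictScalars ℝ
  have h2 := ((differentiableOn_partialDeriv hU hY i).differentiableAt
    (hU.mem_nhds hu)).restrictScalars ℝ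
  exact ((h2.dotProduct_star h1).hasWirtingerAt.div (h1.dotProduct_star h1).hasWirtingerAt
    (dotProduct_star_self_ne_zero h0)).1

theorem wirtingerBar_logDeriv {U : Set (Fin m → ℂ)} (hU : IsOpen U)
    {Y : (Fin m → ℂ) → (Fin (n + 1) → ℂ)} (hY : DifferentiableOn ℂ Y U) (hu : u ∈ U)
    (h0 : Y u ≠ 0) (i j : Fin m) :
    wirtingerBar j (logDeriv Y i) u =
      fubiniStudyLeft (Y u) (partialDeriv j Y u) (partialDeriv i Y u) := by
  have h1 := hY.differentiableAt (hU.mem_nhds hu)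
  have h2 := (differentiableOn_partialDeriv hU hY i).differentiableAt (hU.mem_nhds hu)
  exact ((hasWirtingerAt_dotProduct_star h2 h1).div (hasWirtingerAt_dotProduct_star h1 h1)
    (dotProduct_star_self_ne_zero h0)).3 j

theorem hasWirtingerAt_log_norm_sq {Y : (Fin m → ℂ) → (Fin (n + 1) → ℂ)}
    (hY : DifferentiableAt ℂ Y u) (h0 : Y u ≠ 0) :
    HasWirtingerAt (fun v => ((Real.log (∑ k, ‖Y v k‖ ^ 2) : ℝ) : ℂ))
      (fun i => partialDeriv i Y u ⬝ᵥ star (Y u) / (Y u ⬝ᵥ star (Y u)))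
      (fun j => Y u ⬝ᵥ star (partialDeriv j Y u) / (Y u ⬝ᵥ star (Y u))) u := by
  have h := hasWirtingerAt_dotProduct_star hY hY
  simp only [dotProduct_star_self_eq_ofReal] at h ⊢
  exact h.log (sum_norm_sq_ne_zero h0)

/-- Together with `hasWirtingerAt_log_norm_sq`: the form `∂∂̄ log ‖Y‖²` of a nowhere zero
holomorphic map is the pull-back of the Fubini-Study form. -/
theorem hasWirtingerAt_dotProduct_star_div {U : Set (Fin m → ℂ)} (hU : IsOpen U)
    {Y : (Fin m → ℂ) → (Fin (n + 1) → ℂ)} (hY : DifferentiableOn ℂ Y U) (hu : u ∈ U)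
    (h0 : Y u ≠ 0) (j : Fin m) :
    HasWirtingerAt (fun v => Y v ⬝ᵥ star (partialDeriv j Y v) / (Y v ⬝ᵥ star (Y v)))
      (fun i => fubiniStudyLeft (Y u) (partialDeriv j Y u) (partialDeriv i Y u))
      (fun i => Y u ⬝ᵥ star (partialDeriv i (partialDeriv j Y) u) / (Y u ⬝ᵥ star (Y u)) -
        Y u ⬝ᵥ star (partialDeriv j Y u) * Y u ⬝ᵥ star (partialDeriv i Y u) /
          (Y u ⬝ᵥ star (Y u)) ^ 2) u := by
  have h1 := hY.differentiableAt (hU.mem_nhds hu)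
  have h2 := (differentiableOn_partialDeriv hU hY j).differentiableAt (hU.mem_nhds hu)
  have h := (hasWirtingerAt_dotProduct_star h1 h2).div (hasWirtingerAt_dotProduct_star h1 h1)
    (dotProduct_star_self_ne_zero h0)
  refine ⟨h.1, fun i => ?_, h.3⟩
  rw [h.2, fubiniStudyLeft_apply]
  ring

/-- The first derivatives of the pull-back of the Fubini-Study form by a nowhere zero holomorphic
map `Y`. The two correction terms come from the dependence of the form on the point `Y`. -/
theorem wirtinger_fubiniStudy {U : Set (Fin m → ℂ)} (hU : IsOpen U)
    {Y : (Fin m → ℂ) → (Fin (n + 1) → ℂ)} (hY : DifferentiableOn ℂ Y U) (hu : u ∈ U)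
    (h0 : Y u ≠ 0) (i k l : Fin m) :
    wirtinger i (fun v => fubiniStudy (Y v) (partialDeriv k Y v) (partialDeriv l Y v)) u =
      fubiniStudyLeft (Y u) (partialDeriv l Y u) (partialDeriv i (partialDeriv k Y) u -
        logDeriv Y i u • partialDeriv k Y u - logDeriv Y k u • partialDeriv i Y u) := by
  have hq := dotProduct_star_self_ne_zero h0
  have h1 := hY.differentiableAt (hU.mem_nhds hu)
  have h2 : ∀ k, DifferentiableAt ℂ (partialDeriv k Y) u := fun k =>
    (differentiableOn_partialDeriv hU hY k).differentiableAt (hU.mem_nhds hu)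
  have h11 := hasWirtingerAt_dotProduct_star h1 h1
  have h := ((hasWirtingerAt_dotProduct_star (h2 k) (h2 l)).div h11 hq).sub
    (((hasWirtingerAt_dotProduct_star (h2 k) h1).mul (hasWirtingerAt_dotProduct_star h1 (h2 l))).div
      (h11.mul h11) (mul_ne_zero hq hq))
  have he : (fun v => fubiniStudy (Y v) (partialDeriv k Y v) (partialDeriv l Y v)) = fun v =>
      partialDeriv k Y v ⬝ᵥ star (partialDeriv l Y v) / (Y v ⬝ᵥ star (Y v)) -
        partialDeriv k Y v ⬝ᵥ star (Y v) * Y v ⬝ᵥ star (partialDeriv l Y v) /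
          (Y v ⬝ᵥ star (Y v) * Y v ⬝ᵥ star (Y v)) := by
    funext v
    rw [← sq]
    rfl
  rw [he, h.2]
  simp only [map_sub, map_smul, smul_eq_mul, fubiniStudyLeft_apply, logDeriv]
  field_simp
  ring

end Calculus

/-! ### Hypersurface patches with a conormal vector -/

/-- A piece of a complex hypersurface of `ℂPⁿ`, parametrised by `u ↦ [Z u]`, together with a
nowhere zero holomorphic function `ν` whose value at `u` is a linear form on `ℂⁿ⁺¹` vanishing on
the tangent hyperplane at `[Z u]`, i.e. on `Z` and on all `∂_i Z`. Thus `star (ν u)` is a normal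
vector. For `{F = 0}` the form `ν` is the gradient of `F`. -/
structure ConormalPatch (n m : ℕ) where
  domain : Set (Fin m → ℂ)
  isOpen_domain : IsOpen domain
  Z : (Fin m → ℂ) → (Fin (n + 1) → ℂ)
  ν : (Fin m → ℂ) → (Fin (n + 1) → ℂ)
  holomorphic_Z : DifferentiableOn ℂ Z domain
  holomorphic_ν : DifferentiableOn ℂ ν domain
  Z_ne_zero : ∀ u ∈ domain, Z u ≠ 0
  ν_ne_zero : ∀ u ∈ domain, ν u ≠ 0
  ν_dot_Z : ∀ u ∈ domain, ν u ⬝ᵥ Z u = 0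
  ν_dot_partialDeriv : ∀ u ∈ domain, ∀ i, ν u ⬝ᵥ partialDeriv i Z u = 0
  immersion : ∀ u ∈ domain, ∀ v, fderiv ℂ Z u v ∈ Submodule.span ℂ {Z u} → v = 0
  dim_eq : n = m + 1

namespace ConormalPatch

variable {n m : ℕ} (P : ConormalPatch n m) {u : Fin m → ℂ}

/-- The coefficients of the induced Fubini-Study metric. -/
def metric (u : Fin m → ℂ) : Matrix (Fin m) (Fin m) ℂ :=
  Matrix.of fun i j => fubiniStudy (P.Z u) (partialDeriv i P.Z u) (partialDeriv j P.Z u)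

theorem metric_apply (u : Fin m → ℂ) (i j : Fin m) :
    P.metric u i j = fubiniStudyLeft (P.Z u) (partialDeriv j P.Z u) (partialDeriv i P.Z u) := rfl

theorem differentiableAt_Z (hu : u ∈ P.domain) : DifferentiableAt ℂ P.Z u :=
  P.holomorphic_Z.differentiableAt (P.isOpen_domain.mem_nhds hu)

theorem differentiableAt_ν (hu : u ∈ P.domain) : DifferentiableAt ℂ P.ν u :=
  P.holomorphic_ν.differentiableAt (P.isOpen_domain.mem_nhds hu)

theorem differentiableOn_dZ (i : Fin m) : DifferentiableOn ℂ (partialDeriv i P.Z) P.domain :=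
  differentiableOn_partialDeriv P.isOpen_domain P.holomorphic_Z i

theorem differentiableAt_dZ (hu : u ∈ P.domain) (i : Fin m) :
    DifferentiableAt ℂ (partialDeriv i P.Z) u :=
  (P.differentiableOn_dZ i).differentiableAt (P.isOpen_domain.mem_nhds hu)

theorem differentiableAt_ddZ (hu : u ∈ P.domain) (i k : Fin m) :
    DifferentiableAt ℂ (partialDeriv i (partialDeriv k P.Z)) u :=
  (differentiableOn_partialDeriv P.isOpen_domain (P.differentiableOn_dZ k) i).differentiableAt
    (P.isOpen_domain.mem_nhds hu)

theorem dν_dot_Z (hu : u ∈ P.domain) (i : Fin m) : partialDeriv i P.ν u ⬝ᵥ P.Z u = 0 := by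
  have h : (fun v => P.ν v ⬝ᵥ P.Z v) =ᶠ[nhds u] fun _ => 0 :=
    (P.isOpen_domain.eventually_mem hu).mono P.ν_dot_Z
  have h1 := h.wirtinger_eq i
  rw [(hasWirtingerAt_dotProduct (P.differentiableAt_ν hu) (P.differentiableAt_Z hu)).2,
    (HasWirtingerAt.const 0 u).2, P.ν_dot_partialDeriv u hu, add_zero] at h1
  exact h1

/-- Differentiating `ν(∂_k Z) = 0`. -/
theorem dν_dot_dZ (hu : u ∈ P.domain) (i k : Fin m) :
    partialDeriv i P.ν u ⬝ᵥ partialDeriv k P.Z u =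
      -(P.ν u ⬝ᵥ partialDeriv i (partialDeriv k P.Z) u) := by
  have h : (fun v => P.ν v ⬝ᵥ partialDeriv k P.Z v) =ᶠ[nhds u] fun _ => 0 :=
    (P.isOpen_domain.eventually_mem hu).mono fun v hv => P.ν_dot_partialDeriv v hv k
  have h1 := h.wirtinger_eq i
  rw [(hasWirtingerAt_dotProduct (P.differentiableAt_ν hu) (P.differentiableAt_dZ hu k)).2,
    (HasWirtingerAt.const 0 u).2] at h1
  exact eq_neg_of_add_eq_zero_left h1

/-! ### The moving frame `(∂₁Z, …, ∂_m Z, Z, ν̄)` -/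

/-- The linear combinations of the moving frame `(∂₁Z, …, ∂_m Z, Z, ν̄)` at `u`. -/
def frameMap (u : Fin m → ℂ) : ((Fin m → ℂ) × ℂ × ℂ) →ₗ[ℂ] (Fin (n + 1) → ℂ) :=
  (Fintype.linearCombination ℂ (fun l => partialDeriv l P.Z u)).coprod
    ((LinearMap.toSpanSingleton ℂ _ (P.Z u)).coprod
      (LinearMap.toSpanSingleton ℂ _ (star (P.ν u))))

theorem frameMap_apply (u t : Fin m → ℂ) (τ ρ : ℂ) :
    P.frameMap u (t, τ, ρ) =
      ∑ l, t l • partialDeriv l P.Z u + (τ • P.Z u + ρ • star (P.ν u)) := by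
  simp [frameMap, Fintype.linearCombination_apply]

theorem ν_dot_frameMap (hu : u ∈ P.domain) (t : Fin m → ℂ) (τ ρ : ℂ) :
    P.ν u ⬝ᵥ P.frameMap u (t, τ, ρ) = ρ * P.ν u ⬝ᵥ star (P.ν u) := by
  simp [frameMap_apply, dotProduct_add, dotProduct_sum, dotProduct_smul, P.ν_dot_Z u hu,
    P.ν_dot_partialDeriv u hu]

theorem frameMap_injective (hu : u ∈ P.domain) : Function.Injective (P.frameMap u) := by
  rw [injective_iff_map_eq_zero]
  rintro ⟨t, τ, ρ⟩ h
  have hρ : ρ = 0 := by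
    have h1 := P.ν_dot_frameMap hu t τ ρ
    rw [h, dotProduct_zero] at h1
    exact (mul_eq_zero.mp h1.symm).resolve_right
      (dotProduct_star_self_ne_zero (P.ν_ne_zero u hu))
  rw [frameMap_apply, hρ, zero_smul, add_zero] at h
  have hsum : fderiv ℂ P.Z u t = ∑ l, t l • partialDeriv l P.Z u := by
    conv_lhs => rw [← Finset.univ_sum_single t]
    simp only [map_sum, partialDeriv, ← map_smul]
    refine Finset.sum_congr rfl fun l _ => ?_
    rw [← Pi.single_smul, smul_eq_mul, mul_one]
  have ht : t = 0 := P.immersion u hu t (by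
    rw [hsum, eq_neg_of_add_eq_zero_left h, ← neg_smul]
    exact Submodule.smul_mem _ _ (Submodule.mem_span_singleton_self _))
  have hτ : τ = 0 := by
    simpa [ht, P.Z_ne_zero u hu] using h
  simp [ht, hτ, hρ]

theorem exists_frameMap_eq (hu : u ∈ P.domain) (X : Fin (n + 1) → ℂ) :
    ∃ t τ ρ, P.frameMap u (t, τ, ρ) = X := by
  have hdim : Module.finrank ℂ ((Fin m → ℂ) × ℂ × ℂ) = Module.finrank ℂ (Fin (n + 1) → ℂ) := by
    simp [P.dim_eq]
  obtain ⟨⟨t, τ, ρ⟩, h⟩ := (LinearMap.injective_iff_surjective_of_finrank_eq_finrank hdim).mp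
    (P.frameMap_injective hu) X
  exact ⟨t, τ, ρ, h⟩

theorem normal_dot_star_Z (hu : u ∈ P.domain) : star (P.ν u) ⬝ᵥ star (P.Z u) = 0 := by
  rw [Matrix.star_dotProduct_star, dotProduct_comm, P.ν_dot_Z u hu, star_zero]

theorem normal_dot_star_dZ (hu : u ∈ P.domain) (i : Fin m) :
    star (P.ν u) ⬝ᵥ star (partialDeriv i P.Z u) = 0 := by
  rw [Matrix.star_dotProduct_star, dotProduct_comm, P.ν_dot_partialDeriv u hu, star_zero]

theorem fubiniStudyLeft_frameMap (hu : u ∈ P.domain) (t : Fin m → ℂ) (τ ρ : ℂ) (j : Fin m) :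
    fubiniStudyLeft (P.Z u) (partialDeriv j P.Z u) (P.frameMap u (t, τ, ρ)) =
      ∑ l, t l * P.metric u l j := by
  have h : fubiniStudyLeft (P.Z u) (partialDeriv j P.Z u) (star (P.ν u)) = 0 := by
    simp [fubiniStudyLeft_apply, P.normal_dot_star_Z hu, P.normal_dot_star_dZ hu]
  simp [frameMap_apply, fubiniStudyLeft_self (P.Z_ne_zero u hu), h, metric_apply]

/-- A vector is zero if it is orthogonal to `Z` and `ν̄`, and Fubini-Study orthogonal to all
`∂_j Z`. -/
theorem eq_zero_of_orthogonal (hu : u ∈ P.domain) {X : Fin (n + 1) → ℂ}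
    (hZ : X ⬝ᵥ star (P.Z u) = 0) (hν : P.ν u ⬝ᵥ X = 0)
    (hd : ∀ j, fubiniStudyLeft (P.Z u) (partialDeriv j P.Z u) X = 0) : X = 0 := by
  have hd' : ∀ j, X ⬝ᵥ star (partialDeriv j P.Z u) = 0 := fun j => by
    have h := hd j
    rw [fubiniStudyLeft_apply, hZ, zero_mul, zero_div, sub_zero] at h
    exact (div_eq_zero_iff.mp h).resolve_right
      (dotProduct_star_self_ne_zero (P.Z_ne_zero u hu))
  obtain ⟨t, τ, ρ, h⟩ := P.exists_frameMap_eq hu X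
  by_contra hX
  refine dotProduct_star_self_ne_zero hX ?_
  have hself : X ⬝ᵥ star X = P.frameMap u (t, τ, ρ) ⬝ᵥ star X := by rw [h]
  rw [hself, frameMap_apply]
  have e1 : ∀ Y : Fin (n + 1) → ℂ, X ⬝ᵥ star Y = 0 → Y ⬝ᵥ star X = 0 := fun Y hY => by
    rw [← star_dotProduct_comm, hY, star_zero]
  have e2 : star (P.ν u) ⬝ᵥ star X = 0 := by
    rw [Matrix.star_dotProduct_star, dotProduct_comm, hν, star_zero]
  simp [add_dotProduct, sum_dotProduct, smul_dotProduct, e1 _ hZ, e1 _ (hd' _), e2]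

theorem det_metric_ne_zero (hu : u ∈ P.domain) : (P.metric u).det ≠ 0 := by
  intro hdet
  obtain ⟨t, ht, h⟩ := Matrix.exists_vecMul_eq_zero_iff.mpr hdet
  -- A null vector `t` of the metric gives the vector `∑ t_l ∂_l Z`, whose projection along `Z` onto
  -- the orthogonal complement of `Z` is orthogonal to the whole frame.
  set Y := ∑ l, t l • partialDeriv l P.Z u with hY
  set τ := -(Y ⬝ᵥ star (P.Z u) / (P.Z u ⬝ᵥ star (P.Z u))) with hτ
  have hq := dotProduct_star_self_ne_zero (P.Z_ne_zero u hu)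
  have hX : P.frameMap u (t, τ, 0) = 0 := by
    refine P.eq_zero_of_orthogonal hu ?_ ?_ fun j => ?_
    · rw [frameMap_apply, ← hY, zero_smul, add_zero, add_dotProduct, smul_dotProduct, hτ,
        smul_eq_mul]
      field_simp
      ring
    · rw [P.ν_dot_frameMap hu, zero_mul]
    · rw [P.fubiniStudyLeft_frameMap hu]
      exact congrFun h j
  have := P.frameMap_injective hu (hX.trans (map_zero _).symm)
  exact ht (congrArg Prod.fst this)

theorem inv_mul_metric (hu : u ∈ P.domain) : (P.metric u)⁻¹ * P.metric u = 1 :=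
  Matrix.nonsing_inv_mul _ (isUnit_iff_ne_zero.mpr (P.det_metric_ne_zero hu))

/-! ### The Gauss formula -/

/-- The vector `∂_i∂_k Z - a_i ∂_k Z - a_k ∂_i Z`, `a_i = ∂_i log |Z|²`: the second derivative of
`Z`, corrected so that its Fubini-Study products are the derivatives of the metric. -/
def secondDeriv (i k : Fin m) (u : Fin m → ℂ) : Fin (n + 1) → ℂ :=
  partialDeriv i (partialDeriv k P.Z) u - logDeriv P.Z i u • partialDeriv k P.Z u -
    logDeriv P.Z k u • partialDeriv i P.Z u

theorem christoffel_eq (hu : u ∈ P.domain) (i k l : Fin m) :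
    christoffel P.metric i k l u =
      ∑ s, fubiniStudyLeft (P.Z u) (partialDeriv s P.Z u) (P.secondDeriv i k u) *
        (P.metric u)⁻¹ s l :=
  Finset.sum_congr rfl fun s _ => congrArg (· * (P.metric u)⁻¹ s l)
    (wirtinger_fubiniStudy P.isOpen_domain P.holomorphic_Z hu (P.Z_ne_zero u hu) i k s)

theorem sum_christoffel_mul_metric (hu : u ∈ P.domain) (i k j : Fin m) :
    ∑ l, christoffel P.metric i k l u * P.metric u l j =
      fubiniStudyLeft (P.Z u) (partialDeriv j P.Z u) (P.secondDeriv i k u) := by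
  have h : ∀ s, ∑ l, (P.metric u)⁻¹ s l * P.metric u l j = if s = j then 1 else 0 := fun s => by
    rw [← Matrix.mul_apply, P.inv_mul_metric hu, Matrix.one_apply]
  simp only [P.christoffel_eq hu, Finset.sum_mul, mul_assoc]
  rw [Finset.sum_comm]
  simp [← Finset.mul_sum, h]

/-- The second fundamental form, in the direction of the normal vector `ν̄`. -/
def secondFundamental (i k : Fin m) (u : Fin m → ℂ) : ℂ :=
  P.ν u ⬝ᵥ partialDeriv i (partialDeriv k P.Z) u / (P.ν u ⬝ᵥ star (P.ν u))

theorem secondFundamental_comm (hu : u ∈ P.domain) (i k : Fin m) :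
    P.secondFundamental i k u = P.secondFundamental k i u := by
  unfold secondFundamental
  rw [partialDeriv_comm P.isOpen_domain P.holomorphic_Z hu]

/-- The coefficient of `Z` in the decomposition of `∂_i∂_k Z` in the moving frame. -/
def radialCoeff (i k : Fin m) (u : Fin m → ℂ) : ℂ :=
  (P.secondDeriv i k u - ∑ l, christoffel P.metric i k l u • partialDeriv l P.Z u) ⬝ᵥ
    star (P.Z u) / (P.Z u ⬝ᵥ star (P.Z u))

/-- The Gauss formula: the tangential component of the (corrected) second derivative is given by
the Christoffel symbols, the normal one by the second fundamental form. -/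
theorem secondDeriv_eq (hu : u ∈ P.domain) (i k : Fin m) :
    P.secondDeriv i k u = P.frameMap u (fun l => christoffel P.metric i k l u,
      P.radialCoeff i k u, P.secondFundamental i k u) := by
  have hq := dotProduct_star_self_ne_zero (P.Z_ne_zero u hu)
  have hp := dotProduct_star_self_ne_zero (P.ν_ne_zero u hu)
  refine sub_eq_zero.mp (P.eq_zero_of_orthogonal hu ?_ ?_ fun j => ?_)
  · rw [frameMap_apply, ← sub_sub, sub_dotProduct, add_dotProduct, smul_dotProduct,
      smul_dotProduct, P.normal_dot_star_Z hu, smul_zero, add_zero, smul_eq_mul, radialCoeff,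
      div_mul_cancel₀ _ hq, sub_self]
  · rw [dotProduct_sub, P.ν_dot_frameMap hu, secondFundamental, div_mul_cancel₀ _ hp]
    simp [secondDeriv, dotProduct_sub, dotProduct_smul, P.ν_dot_partialDeriv u hu]
  · rw [map_sub, P.fubiniStudyLeft_frameMap hu, P.sum_christoffel_mul_metric hu, sub_self]

end ConormalPatch

/-! ### The curvature of a hypersurface patch -/

theorem _root_.DifferentiableAt.matrix_det {E : Type*} [NormedAddCommGroup E] [NormedSpace ℝ E]
    {m : ℕ} {A : E → Matrix (Fin m) (Fin m) ℂ} {u : E}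
    (hA : ∀ i j, DifferentiableAt ℝ (fun v => A v i j) u) :
    DifferentiableAt ℝ (fun v => (A v).det) u := by
  simp only [Matrix.det_apply]
  exact DifferentiableAt.fun_sum fun σ _ => (HasFDerivAt.finsetProd fun i _ =>
    (hA (σ i) i).hasFDerivAt).differentiableAt.const_smul _

theorem _root_.DifferentiableAt.matrix_inv_apply {m : ℕ}
    {A : (Fin m → ℂ) → Matrix (Fin m) (Fin m) ℂ} {u : Fin m → ℂ}
    (hA : ∀ i j, DifferentiableAt ℝ (fun v => A v i j) u) (h0 : (A u).det ≠ 0) (i j : Fin m) :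
    DifferentiableAt ℝ (fun v => (A v)⁻¹ i j) u := by
  simp only [Matrix.inv_def, Ring.inverse_eq_inv', Matrix.smul_apply, smul_eq_mul,
    Matrix.adjugate_apply]
  refine ((DifferentiableAt.matrix_det hA).hasWirtingerAt.inv h0).1.mul
    (DifferentiableAt.matrix_det fun k l => ?_)
  by_cases hk : k = j
  · subst hk
    simp
  · simpa [Matrix.updateRow_ne hk] using hA k l

namespace ConormalPatch

variable {n m : ℕ} (P : ConormalPatch n m) {u : Fin m → ℂ}

theorem differentiableAt_logDeriv_Z (hu : u ∈ P.domain) (i : Fin m) :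
    DifferentiableAt ℝ (logDeriv P.Z i) u :=
  differentiableAt_logDeriv P.isOpen_domain P.holomorphic_Z hu (P.Z_ne_zero u hu) i

theorem differentiableAt_secondDeriv (hu : u ∈ P.domain) (i k : Fin m) :
    DifferentiableAt ℝ (P.secondDeriv i k) u :=
  (((P.differentiableAt_ddZ hu i k).restrictScalars ℝ).sub
    ((P.differentiableAt_logDeriv_Z hu i).smul
      ((P.differentiableAt_dZ hu k).restrictScalars ℝ))).sub
    ((P.differentiableAt_logDeriv_Z hu k).smul
      ((P.differentiableAt_dZ hu i).restrictScalars ℝ))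

theorem differentiableAt_metric (hu : u ∈ P.domain) (i j : Fin m) :
    DifferentiableAt ℝ (fun v => P.metric v i j) u :=
  ((P.differentiableAt_Z hu).restrictScalars ℝ).fubiniStudyLeft
    ((P.differentiableAt_dZ hu i).restrictScalars ℝ)
    ((P.differentiableAt_dZ hu j).restrictScalars ℝ) (P.Z_ne_zero u hu)

theorem differentiableAt_christoffel (hu : u ∈ P.domain) (i k l : Fin m) :
    DifferentiableAt ℝ (christoffel P.metric i k l) u := by
  refine DifferentiableAt.congr_of_eventuallyEq ?_
    ((P.isOpen_domain.eventually_mem hu).mono fun v hv => P.christoffel_eq hv i k l)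
  exact DifferentiableAt.fun_sum fun s _ =>
    (((P.differentiableAt_Z hu).restrictScalars ℝ).fubiniStudyLeft
      (P.differentiableAt_secondDeriv hu i k)
      ((P.differentiableAt_dZ hu s).restrictScalars ℝ) (P.Z_ne_zero u hu)).mul
    (DifferentiableAt.matrix_inv_apply (P.differentiableAt_metric hu)
      (P.det_metric_ne_zero hu) s l)

theorem differentiableAt_secondFundamental (hu : u ∈ P.domain) (i k : Fin m) :
    DifferentiableAt ℝ (P.secondFundamental i k) u :=
  ((hasWirtingerAt_dotProduct (P.differentiableAt_ν hu) (P.differentiableAt_ddZ hu i k)).div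
    (hasWirtingerAt_dotProduct_star (P.differentiableAt_ν hu) (P.differentiableAt_ν hu))
    (dotProduct_star_self_ne_zero (P.ν_ne_zero u hu))).1

theorem differentiableAt_radialCoeff (hu : u ∈ P.domain) (i k : Fin m) :
    DifferentiableAt ℝ (P.radialCoeff i k) u := by
  have hZ := (P.differentiableAt_Z hu).restrictScalars ℝ
  have h : DifferentiableAt ℝ (fun v => P.secondDeriv i k v -
      ∑ l, christoffel P.metric i k l v • partialDeriv l P.Z v) u :=
    (P.differentiableAt_secondDeriv hu i k).sub (DifferentiableAt.fun_sum fun l _ =>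
      (P.differentiableAt_christoffel hu i k l).smul
        ((P.differentiableAt_dZ hu l).restrictScalars ℝ))
  exact ((h.dotProduct_star hZ).hasWirtingerAt.div (hZ.dotProduct_star hZ).hasWirtingerAt
    (dotProduct_star_self_ne_zero (P.Z_ne_zero u hu))).1

/-- The `∂̄_j`-derivative of the Gauss formula `secondDeriv_eq`. The left-hand side is holomorphic
up to the functions `∂_i log |Z|²`, whose `∂̄_j`-derivatives are the metric coefficients; on the
right-hand side `ν̄` is the only member of the moving frame that is not holomorphic. -/
theorem wirtingerBar_secondDeriv_eq (hu : u ∈ P.domain) (i k j : Fin m) :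
    -(P.metric u i j • partialDeriv k P.Z u + P.metric u k j • partialDeriv i P.Z u) =
      P.frameMap u (fun l => wirtingerBar j (christoffel P.metric i k l) u,
        wirtingerBar j (P.radialCoeff i k) u, wirtingerBar j (P.secondFundamental i k) u) +
      P.secondFundamental i k u • star (partialDeriv j P.ν u) := by
  have hZ := hasWirtingerAt_apply (P.differentiableAt_Z hu)
  have hdZ := fun l => hasWirtingerAt_apply (P.differentiableAt_dZ hu l)
  have hν := fun p => (hasWirtingerAt_apply (P.differentiableAt_ν hu) p).star
  have ha := fun l => (P.differentiableAt_logDeriv_Z hu l).hasWirtingerAt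
  funext p
  have hL := ((hasWirtingerAt_apply (P.differentiableAt_ddZ hu i k) p).sub
    ((ha i).mul (hdZ k p))).sub ((ha k).mul (hdZ i p))
  have hR := (HasWirtingerAt.sum (s := Finset.univ) fun l _ =>
    (P.differentiableAt_christoffel hu i k l).hasWirtingerAt.mul (hdZ l p)).add
    (((P.differentiableAt_radialCoeff hu i k).hasWirtingerAt.mul (hZ p)).add
      ((P.differentiableAt_secondFundamental hu i k).hasWirtingerAt.mul (hν p)))
  have he : (fun v => P.secondDeriv i k v p) =ᶠ[nhds u] fun v => P.frameMap v
      (fun l => christoffel P.metric i k l v, P.radialCoeff i k v, P.secondFundamental i k v) p :=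
    (P.isOpen_domain.eventually_mem hu).mono fun v hv => congrFun (P.secondDeriv_eq hv i k) p
  have h := he.wirtingerBar_eq j
  simp only [secondDeriv, frameMap_apply, Pi.sub_apply, Pi.add_apply, Pi.smul_apply,
    Finset.sum_apply, smul_eq_mul, Pi.star_apply] at h
  rw [hL.3, hR.3] at h
  simp only [wirtingerBar_logDeriv P.isOpen_domain P.holomorphic_Z hu (P.Z_ne_zero u hu),
    ← metric_apply, Pi.zero_apply, mul_zero, add_zero] at h
  simp only [frameMap_apply, Pi.neg_apply, Pi.add_apply, Pi.smul_apply,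
    Finset.sum_apply, smul_eq_mul, Pi.star_apply]
  linear_combination h

/-- The Gauss equation. There are a symmetric matrix `s` and a matrix `t`, for which `t g` is
symmetric, such that the curvature of the patch is
`R_{k i j̄}^ℓ = g_{k j̄} δ_{iℓ} + g_{i j̄} δ_{kℓ} + s_{ik} t_{jℓ}`, while the Fubini-Study form
pulled back by the conormal map `ν`, i.e. `∂∂̄ log |ν|²`, has the coefficients
`-∑_ℓ s_{iℓ} t_{jℓ}`. Here `s` is the second fundamental form and `t_{jℓ}` is the component of
`∂̄_j ν̄` along `∂_ℓ Z`. -/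
theorem exists_gauss_equation (hu : u ∈ P.domain) :
    ∃ s t : Matrix (Fin m) (Fin m) ℂ, (∀ i k, s i k = s k i) ∧
      (∀ i j, (t * P.metric u) i j = (t * P.metric u) j i) ∧
      (∀ k l i j, curvatureCoeff P.metric k l i j u =
        P.metric u k j * (if i = l then 1 else 0) + P.metric u i j * (if k = l then 1 else 0) +
          s i k * t j l) ∧
      ∀ i j, fubiniStudyLeft (P.ν u) (partialDeriv j P.ν u) (partialDeriv i P.ν u) =
        -∑ l, s i l * t j l := by
  have hp := dotProduct_star_self_ne_zero (P.ν_ne_zero u hu)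
  choose t τ ρ ht using fun j => P.exists_frameMap_eq hu (star (partialDeriv j P.ν u))
  have hdot : ∀ i j, star (partialDeriv j P.ν u) ⬝ᵥ star (partialDeriv i P.Z u) =
      -star (P.ν u ⬝ᵥ partialDeriv j (partialDeriv i P.Z) u) := fun i j => by
    rw [Matrix.star_dotProduct_star, dotProduct_comm, P.dν_dot_dZ hu, star_neg]
  have hdot' : ∀ j, star (partialDeriv j P.ν u) ⬝ᵥ star (P.Z u) = 0 := fun j => by
    rw [Matrix.star_dotProduct_star, dotProduct_comm, P.dν_dot_Z hu, star_zero]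
  refine ⟨Matrix.of fun i k => P.secondFundamental i k u, Matrix.of t,
    fun i k => P.secondFundamental_comm hu i k, fun i j => ?_, fun k l i j => ?_, fun i j => ?_⟩
  · have h : ∀ i j, (Matrix.of t * P.metric u) i j =
        -star (P.ν u ⬝ᵥ partialDeriv i (partialDeriv j P.Z) u) / (P.Z u ⬝ᵥ star (P.Z u)) :=
      fun i j => by
        rw [Matrix.mul_apply]
        simp only [Matrix.of_apply]
        rw [← P.fubiniStudyLeft_frameMap hu (t i) (τ i) (ρ i), ht, fubiniStudyLeft_apply, hdot,
          hdot', zero_mul, zero_div, sub_zero]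
    rw [h, h, partialDeriv_comm P.isOpen_domain P.holomorphic_Z hu]
  · -- Expand the `∂̄_j`-derivative of the Gauss formula in the frame; the coefficient of `∂_ℓ Z`
    -- vanishes.
    have h := P.wirtingerBar_secondDeriv_eq hu i k j
    rw [← ht j] at h
    have h0 : P.frameMap u
        ((fun l => wirtingerBar j (christoffel P.metric i k l) u + P.secondFundamental i k u * t j l
            + P.metric u i j * (if k = l then 1 else 0) + P.metric u k j * (if i = l then 1 else 0)),
          wirtingerBar j (P.radialCoeff i k) u + P.secondFundamental i k u * τ j,
          wirtingerBar j (P.secondFundamental i k) u + P.secondFundamental i k u * ρ j) = 0 := by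
      have hsplit : P.frameMap u
          ((fun l => wirtingerBar j (christoffel P.metric i k l) u +
              P.secondFundamental i k u * t j l + P.metric u i j * (if k = l then 1 else 0) +
              P.metric u k j * (if i = l then 1 else 0)),
            wirtingerBar j (P.radialCoeff i k) u + P.secondFundamental i k u * τ j,
            wirtingerBar j (P.secondFundamental i k) u + P.secondFundamental i k u * ρ j) =
          (P.frameMap u (fun l => wirtingerBar j (christoffel P.metric i k l) u,
            wirtingerBar j (P.radialCoeff i k) u, wirtingerBar j (P.secondFundamental i k) u) +
          P.secondFundamental i k u • P.frameMap u (t j, τ j, ρ j)) +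
          (P.metric u i j • partialDeriv k P.Z u + P.metric u k j • partialDeriv i P.Z u) := by
        simp only [frameMap_apply, add_smul, mul_smul, Finset.sum_add_distrib, ← Finset.smul_sum,
          smul_add, ite_smul, one_smul, zero_smul, Finset.sum_ite_eq, Finset.mem_univ, if_true]
        abel
      rw [hsplit, ← h, neg_add_cancel]
    have h1 := congrFun (congrArg Prod.fst
      (P.frameMap_injective hu (h0.trans (map_zero _).symm))) l
    simp only [Prod.fst_zero, Pi.zero_apply] at h1
    simp only [curvatureCoeff, Matrix.of_apply]
    linear_combination -h1
  · have hρ : ρ j * P.ν u ⬝ᵥ star (P.ν u) = P.ν u ⬝ᵥ star (partialDeriv j P.ν u) := by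
      rw [← ht j, P.ν_dot_frameMap hu]
    have hij : partialDeriv i P.ν u ⬝ᵥ star (partialDeriv j P.ν u) =
        -∑ l, t j l * P.ν u ⬝ᵥ partialDeriv i (partialDeriv l P.Z) u +
          ρ j * partialDeriv i P.ν u ⬝ᵥ star (P.ν u) := by
      rw [← ht j, frameMap_apply]
      simp [dotProduct_add, dotProduct_sum, dotProduct_smul, P.dν_dot_Z hu, P.dν_dot_dZ hu]
    have hs : ∑ l, P.secondFundamental i l u * t j l =
        (∑ l, t j l * P.ν u ⬝ᵥ partialDeriv i (partialDeriv l P.Z) u) /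
          (P.ν u ⬝ᵥ star (P.ν u)) := by
      rw [Finset.sum_div]
      refine Finset.sum_congr rfl fun l _ => ?_
      rw [secondFundamental]
      ring
    simp only [Matrix.of_apply]
    rw [fubiniStudyLeft_apply, hij, ← hρ, hs]
    field_simp
    ring

end ConormalPatch

/-! ### Traces of powers of matrices of two-forms -/

/-- `trace ((ω + A + B)ʲ)` when `A`, `B` behave like matrices of rank one: `A² = -ωA`,
`B² = -τB`, `AB = BA = 0`. -/
theorem trace_pow_of_mul_self {ι R S : Type*} [Fintype ι] [DecidableEq ι] [CommRing R] [Ring S]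
    [Algebra R S] {ω τ : R} {A B : Matrix ι ι S} (hAA : A * A = -(ω • A)) (hBB : B * B = -(τ • B))
    (hAB : A * B = 0) (hBA : B * A = 0) (hA : A.trace = algebraMap R S ω)
    (hB : B.trace = algebraMap R S τ) (j : ℕ) :
    ((ω • (1 : Matrix ι ι S) + A + B) ^ (j + 1)).trace =
      algebraMap R S ((Fintype.card ι + 2) * ω ^ (j + 1) - (ω - τ) ^ (j + 1)) := by
  -- The powers are `ω^(j+1) + ω^j A + p B` for a polynomial `p` in `ω`, `τ`, which satisfies
  -- `p τ = ω^(j+1) - (ω - τ)^(j+1)`.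
  obtain ⟨p, hp, hpow⟩ : ∃ p : R, p * τ = ω ^ (j + 1) - (ω - τ) ^ (j + 1) ∧
      (ω • (1 : Matrix ι ι S) + A + B) ^ (j + 1) =
        ω ^ (j + 1) • (1 : Matrix ι ι S) + ω ^ j • A + p • B := by
    induction j with
    | zero => exact ⟨1, by ring, by simp⟩
    | succ j ih =>
      obtain ⟨p, hp, hpow⟩ := ih
      refine ⟨ω ^ (j + 1) + (ω - τ) * p, by linear_combination (ω - τ) * hp, ?_⟩
      rw [pow_succ', hpow]
      simp only [mul_add, add_mul, Matrix.mul_smul, Matrix.smul_mul, one_mul, mul_one, hAA, hBB,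
        hAB, hBA, smul_neg, smul_zero, add_zero]
      module
  rw [hpow, Matrix.trace_add, Matrix.trace_add, Matrix.trace_smul, Matrix.trace_smul,
    Matrix.trace_smul, hA, hB, Matrix.trace_one, Algebra.smul_def, Algebra.smul_def,
    Algebra.smul_def, ← map_natCast (algebraMap R S), ← map_mul, ← map_mul, ← map_mul, ← map_add,
    ← map_add, hp]
  congr 1
  ring

section ExteriorAlgebra

variable {V : Type*} [AddCommGroup V] [Module ℂ V]

theorem ι_mul_ι_swap (a b : V) :
    ExteriorAlgebra.ι ℂ a * ExteriorAlgebra.ι ℂ b =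
      -(ExteriorAlgebra.ι ℂ b * ExteriorAlgebra.ι ℂ a) :=
  eq_neg_of_add_eq_zero_left (ExteriorAlgebra.ι_add_mul_swap a b)

theorem ι_mul_ι_mem_center (a b : V) :
    ExteriorAlgebra.ι ℂ a * ExteriorAlgebra.ι ℂ b ∈
      Subalgebra.center ℂ (ExteriorAlgebra ℂ V) := by
  rw [Subalgebra.mem_center_iff]
  intro c
  induction c using ExteriorAlgebra.induction with
  | algebraMap r => exact Algebra.commutes r _
  | ι x =>
    rw [← mul_assoc, ι_mul_ι_swap x a, neg_mul, mul_assoc, ι_mul_ι_swap x b, mul_neg, neg_neg,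
      mul_assoc]
  | mul x y hx hy => rw [mul_assoc, hy, ← mul_assoc, hx, mul_assoc]
  | add x y hx hy => rw [add_mul, mul_add, hx, hy]

/-- The trace of the powers of the matrix of two-forms `ω δ_{kl} + x_l ∧ β_k + h_k ∧ t_l`, where
`ω = ∑ x_l ∧ β_l`, `τ = ∑ h_l ∧ t_l`, and the mixed products `∑ x_l ∧ h_l` and `∑ t_l ∧ β_l`
vanish. -/
theorem trace_pow_twoForms {m : ℕ} (x β h t : Fin m → V) {ω τ : ExteriorAlgebra ℂ V}
    (hω : ∑ l, ExteriorAlgebra.ι ℂ (x l) * ExteriorAlgebra.ι ℂ (β l) = ω)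
    (hτ : ∑ l, ExteriorAlgebra.ι ℂ (h l) * ExteriorAlgebra.ι ℂ (t l) = τ)
    (hxh : ∑ l, ExteriorAlgebra.ι ℂ (x l) * ExteriorAlgebra.ι ℂ (h l) = 0)
    (htβ : ∑ l, ExteriorAlgebra.ι ℂ (t l) * ExteriorAlgebra.ι ℂ (β l) = 0)
    {Θ : Matrix (Fin m) (Fin m) (ExteriorAlgebra ℂ V)}
    (hΘ : ∀ k l, Θ k l = (if k = l then ω else 0) +
      ExteriorAlgebra.ι ℂ (x l) * ExteriorAlgebra.ι ℂ (β k) +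
      ExteriorAlgebra.ι ℂ (h k) * ExteriorAlgebra.ι ℂ (t l)) {j : ℕ} (hj : 1 ≤ j) :
    (Θ ^ j).trace = ((m : ℂ) + 2) • ω ^ j - (ω - τ) ^ j := by
  have hωc : ω ∈ Subalgebra.center ℂ (ExteriorAlgebra ℂ V) :=
    hω ▸ Subalgebra.sum_mem _ fun l _ => ι_mul_ι_mem_center _ _
  have hτc : τ ∈ Subalgebra.center ℂ (ExteriorAlgebra ℂ V) :=
    hτ ▸ Subalgebra.sum_mem _ fun l _ => ι_mul_ι_mem_center _ _
  have hc : ∀ (a b : V) (c : ExteriorAlgebra ℂ V),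
      c * (ExteriorAlgebra.ι ℂ a * ExteriorAlgebra.ι ℂ b) =
        ExteriorAlgebra.ι ℂ a * ExteriorAlgebra.ι ℂ b * c := fun a b =>
    Subalgebra.mem_center_iff.mp (ι_mul_ι_mem_center a b)
  let _ : Algebra (Subalgebra.center ℂ (ExteriorAlgebra ℂ V)) (ExteriorAlgebra ℂ V) :=
    RingHom.toAlgebra' (Subalgebra.center ℂ (ExteriorAlgebra ℂ V)).val.toRingHom
      fun c y => (Subalgebra.mem_center_iff.mp c.2 y).symm
  let A : Matrix (Fin m) (Fin m) (ExteriorAlgebra ℂ V) :=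
    Matrix.of fun k l => ExteriorAlgebra.ι ℂ (x l) * ExteriorAlgebra.ι ℂ (β k)
  let B : Matrix (Fin m) (Fin m) (ExteriorAlgebra ℂ V) :=
    Matrix.of fun k l => ExteriorAlgebra.ι ℂ (h k) * ExteriorAlgebra.ι ℂ (t l)
  have hAA : A * A = -((⟨ω, hωc⟩ : Subalgebra.center ℂ (ExteriorAlgebra ℂ V)) • A) := by
    ext k l
    simp only [A, Matrix.mul_apply, Matrix.of_apply, Matrix.neg_apply, Matrix.smul_apply,
      Subalgebra.smul_def, smul_eq_mul, ← hω, Finset.sum_mul, ← Finset.sum_neg_distrib]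
    refine Finset.sum_congr rfl fun i _ => ?_
    rw [mul_assoc, ← mul_assoc (ExteriorAlgebra.ι ℂ (β k)), ← hc, ι_mul_ι_swap (β k) (x l),
      mul_neg, mul_neg, ← mul_assoc]
  have hBB : B * B = -((⟨τ, hτc⟩ : Subalgebra.center ℂ (ExteriorAlgebra ℂ V)) • B) := by
    ext k l
    simp only [B, Matrix.mul_apply, Matrix.of_apply, Matrix.neg_apply, Matrix.smul_apply,
      Subalgebra.smul_def, smul_eq_mul, ← hτ, Finset.sum_mul, ← Finset.sum_neg_distrib]
    refine Finset.sum_congr rfl fun i _ => ?_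
    rw [mul_assoc, ← mul_assoc (ExteriorAlgebra.ι ℂ (t i)), ι_mul_ι_swap (t i) (h i), neg_mul,
      mul_neg, ← mul_assoc, hc, mul_assoc]
  have hAB : A * B = 0 := by
    ext k l
    have hterm : ∀ i, A k i * B i l = -(ExteriorAlgebra.ι ℂ (x i) * ExteriorAlgebra.ι ℂ (h i) *
        (ExteriorAlgebra.ι ℂ (β k) * ExteriorAlgebra.ι ℂ (t l))) := fun i => by
      simp only [A, B, Matrix.of_apply]
      rw [mul_assoc, ← mul_assoc (ExteriorAlgebra.ι ℂ (β k)), ι_mul_ι_swap (β k) (h i), neg_mul,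
        mul_neg, mul_assoc, mul_assoc]
    simp only [Matrix.mul_apply, hterm, Finset.sum_neg_distrib, ← Finset.sum_mul, hxh, zero_mul,
      neg_zero, Matrix.zero_apply]
  have hBA : B * A = 0 := by
    ext k l
    have hterm : ∀ i, B k i * A i l = -(ExteriorAlgebra.ι ℂ (t i) * ExteriorAlgebra.ι ℂ (β i) *
        (ExteriorAlgebra.ι ℂ (h k) * ExteriorAlgebra.ι ℂ (x l))) := fun i => by
      simp only [A, B, Matrix.of_apply]
      rw [ι_mul_ι_swap (x l) (β i), mul_neg, mul_assoc, ← mul_assoc (ExteriorAlgebra.ι ℂ (t i)),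
        ← mul_assoc, hc, mul_assoc]
    simp only [Matrix.mul_apply, hterm, Finset.sum_neg_distrib, ← Finset.sum_mul, htβ, zero_mul,
      neg_zero, Matrix.zero_apply]
  have hΘ' : Θ = (⟨ω, hωc⟩ : Subalgebra.center ℂ (ExteriorAlgebra ℂ V)) •
      (1 : Matrix (Fin m) (Fin m) (ExteriorAlgebra ℂ V)) + A + B := by
    ext k l
    rw [hΘ]
    simp [A, B, Matrix.one_apply, Subalgebra.smul_def]
  obtain ⟨i, rfl⟩ := Nat.exists_eq_add_of_le' hj
  have htrA : A.trace = algebraMap (Subalgebra.center ℂ (ExteriorAlgebra ℂ V)) _ ⟨ω, hωc⟩ := hω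
  have htrB : B.trace = algebraMap (Subalgebra.center ℂ (ExteriorAlgebra ℂ V)) _ ⟨τ, hτc⟩ := hτ
  rw [hΘ']
  refine (trace_pow_of_mul_self hAA hBB hAB hBA htrA htrB i).trans ?_
  have h2 : ∀ y : Subalgebra.center ℂ (ExteriorAlgebra ℂ V),
      algebraMap (Subalgebra.center ℂ (ExteriorAlgebra ℂ V)) (ExteriorAlgebra ℂ V) y = y :=
    fun _ => rfl
  rw [h2, Fintype.card_fin, Algebra.smul_def, map_add, map_natCast, map_ofNat]
  rfl

end ExteriorAlgebra

/-! ### Forms of type `(1,1)` as sums of products of covectors -/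

/-- `du_i` as a covector. -/
def coordCovector {m : ℕ} (i : Fin m) : (Fin m → ℂ) →L[ℝ] ℂ :=
  (ContinuousLinearMap.proj i : (Fin m → ℂ) →L[ℂ] ℂ).restrictScalars ℝ

/-- `dū_i` as a covector. -/
def conjCovector {m : ℕ} (i : Fin m) : (Fin m → ℂ) →L[ℝ] ℂ :=
  (Complex.conjCLE : ℂ →L[ℝ] ℂ).comp (coordCovector i)

theorem oneOneForm_add {m : ℕ} (A B : Matrix (Fin m) (Fin m) ℂ) :
    oneOneForm (A + B) = oneOneForm A + oneOneForm B := by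
  simp only [oneOneForm, Matrix.add_apply, add_smul, Finset.sum_add_distrib, smul_add]

theorem oneOneForm_smul {m : ℕ} (c : ℂ) (A : Matrix (Fin m) (Fin m) ℂ) :
    oneOneForm (c • A) = c • oneOneForm A := by
  simp only [oneOneForm, Matrix.smul_apply, smul_assoc, ← Finset.smul_sum]
  rw [smul_comm]

theorem oneOneForm_sum {m : ℕ} {ι : Type*} (s : Finset ι) (A : ι → Matrix (Fin m) (Fin m) ℂ) :
    oneOneForm (∑ l ∈ s, A l) = ∑ l ∈ s, oneOneForm (A l) := by
  classical
  induction s using Finset.induction_on with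
  | empty => simp [oneOneForm]
  | insert l s hl ih => rw [Finset.sum_insert hl, Finset.sum_insert hl, oneOneForm_add, ih]

theorem ι_mul_ι_eq_oneOneForm {m : ℕ} (a b : Fin m → ℂ) :
    ExteriorAlgebra.ι ℂ (∑ i, a i • coordCovector i) *
        ExteriorAlgebra.ι ℂ ((Complex.I / (2 * (Real.pi : ℂ))) • ∑ j, b j • conjCovector j) =
      oneOneForm (Matrix.vecMulVec a b) := by
  simp only [map_sum, map_smul, oneOneForm, Matrix.vecMulVec_apply, mul_smul_comm,
    Finset.sum_mul_sum, smul_mul_assoc, smul_smul]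
  congr 1
  refine Finset.sum_congr rfl fun i _ => Finset.sum_congr rfl fun j _ => ?_
  rw [mul_comm]
  rfl

theorem sum_symm_smul_ι_mul_ι {m : ℕ} {V : Type*} [AddCommGroup V] [Module ℂ V]
    {A : Matrix (Fin m) (Fin m) ℂ} (hA : ∀ i j, A i j = A j i) (y : Fin m → V) :
    ∑ i, ∑ j, A i j • (ExteriorAlgebra.ι ℂ (y i) * ExteriorAlgebra.ι ℂ (y j)) = 0 := by
  set X := ∑ i, ∑ j, A i j • (ExteriorAlgebra.ι ℂ (y i) * ExteriorAlgebra.ι ℂ (y j)) with hX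
  suffices h : X = -X by
    calc X = (2 : ℂ)⁻¹ • (X - -X) := by module
      _ = 0 := by rw [← h, sub_self, smul_zero]
  conv_lhs => rw [hX, Finset.sum_comm]
  simp only [hX, ← Finset.sum_neg_distrib]
  refine Finset.sum_congr rfl fun i _ => Finset.sum_congr rfl fun j _ => ?_
  rw [hA, ι_mul_ι_swap, smul_neg]

/-- The trace of the powers of a curvature matrix of the form given by the Gauss equation. -/
theorem trace_pow_of_gauss_equation {m : ℕ} {g s t : Matrix (Fin m) (Fin m) ℂ}
    (hs : ∀ i k, s i k = s k i) (ht : ∀ i j, (t * g) i j = (t * g) j i)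
    {Θ : Matrix (Fin m) (Fin m) (FormAt m)}
    (hΘ : ∀ k l, Θ k l = oneOneForm (Matrix.of fun i j =>
      g k j * (if i = l then 1 else 0) + g i j * (if k = l then 1 else 0) + s i k * t j l))
    {j : ℕ} (hj : 1 ≤ j) :
    (Θ ^ j).trace = ((m : ℂ) + 2) • oneOneForm g ^ j -
      (oneOneForm g - oneOneForm (s * tᵀ)) ^ j := by
  set c : ℂ := Complex.I / (2 * (Real.pi : ℂ))
  have hx : ∀ l : Fin m, coordCovector l = ∑ i, (Pi.single l 1 : Fin m → ℂ) i • coordCovector i :=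
    fun l => by
    rw [Finset.sum_eq_single l (fun i _ hi => ?_) (by simp), Pi.single_eq_same, one_smul]
    rw [Pi.single_eq_of_ne hi]
    exact zero_smul ℂ (coordCovector i)
  refine trace_pow_twoForms coordCovector (fun k => c • ∑ j, g k j • conjCovector j)
    (fun k => ∑ i, s i k • coordCovector i) (fun l => c • ∑ j, t j l • conjCovector j)
    ?_ ?_ ?_ ?_ (fun k l => ?_) hj
  · have h : ∑ l, Matrix.vecMulVec (Pi.single l 1) (g l) = g := by
      ext i j
      simp [Matrix.sum_apply, Matrix.vecMulVec_apply, Pi.single_apply]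
    rw [← h, oneOneForm_sum]
    refine Finset.sum_congr rfl fun l _ => ?_
    rw [hx l, h]
    exact ι_mul_ι_eq_oneOneForm _ _
  · have h : ∑ l, Matrix.vecMulVec (fun i => s i l) (fun j => t j l) = s * tᵀ := by
      ext i j
      simp [Matrix.sum_apply, Matrix.vecMulVec_apply, Matrix.mul_apply]
    rw [← h, oneOneForm_sum]
    exact Finset.sum_congr rfl fun l _ => ι_mul_ι_eq_oneOneForm _ _
  · rw [← sum_symm_smul_ι_mul_ι hs (coordCovector (m := m))]
    refine Finset.sum_congr rfl fun l _ => ?_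
    simp only [map_sum, map_smul, Finset.mul_sum, mul_smul_comm]
    exact Finset.sum_congr rfl fun i _ => by rw [hs]
  · have h := sum_symm_smul_ι_mul_ι ht (conjCovector (m := m))
    simp only [map_sum, map_smul, mul_smul_comm, smul_mul_assoc, Finset.sum_mul_sum, smul_smul,
      ← Finset.smul_sum]
    simp only [Matrix.mul_apply, Finset.sum_smul] at h
    rw [Finset.sum_comm]
    conv_lhs => enter [2, 2, i]; rw [Finset.sum_comm]
    simp only [mul_comm (g _ _)]
    rw [h, smul_zero]
  · have h : (Matrix.of fun i j => g k j * (if i = l then 1 else 0) +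
        g i j * (if k = l then 1 else 0) + s i k * t j l : Matrix (Fin m) (Fin m) ℂ) =
        (if k = l then 1 else 0 : ℂ) • g + Matrix.vecMulVec (Pi.single l 1) (g k) +
          Matrix.vecMulVec (fun i => s i k) (fun j => t j l) := by
      ext i j
      simp only [Matrix.of_apply, Matrix.add_apply, Matrix.smul_apply, Matrix.vecMulVec_apply,
        Pi.single_apply, smul_eq_mul]
      ring
    rw [hΘ, h, oneOneForm_add, oneOneForm_add, oneOneForm_smul, ite_smul, one_smul, zero_smul,
      ← ι_mul_ι_eq_oneOneForm, ← ι_mul_ι_eq_oneOneForm, ← hx l]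

/-! ### The hypersurface `{F = 0}` -/

namespace ConormalPatch

variable {n m : ℕ} (P : ConormalPatch n m) {u : Fin m → ℂ}

/-- The coefficients of `∂∂̄ (log |ν|² - e log |Z|²)`. Both derivatives have to be taken of a function
that has the given form only on the domain of the patch. -/
theorem wirtinger_wirtingerBar_of_eq_log (hu : u ∈ P.domain) {f : (Fin m → ℂ) → ℂ} {e : ℂ}
    (hf : ∀ v ∈ P.domain, f v = ((Real.log (∑ k, ‖P.ν v k‖ ^ 2) : ℝ) : ℂ) -
      e * ((Real.log (∑ k, ‖P.Z v k‖ ^ 2) : ℝ) : ℂ)) (i j : Fin m) :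
    wirtinger i (wirtingerBar j f) u =
      fubiniStudyLeft (P.ν u) (partialDeriv j P.ν u) (partialDeriv i P.ν u) -
        e * P.metric u i j := by
  have h1 : wirtingerBar j f =ᶠ[nhds u] fun v =>
      P.ν v ⬝ᵥ star (partialDeriv j P.ν v) / (P.ν v ⬝ᵥ star (P.ν v)) -
        e * (P.Z v ⬝ᵥ star (partialDeriv j P.Z v) / (P.Z v ⬝ᵥ star (P.Z v))) := by
    filter_upwards [P.isOpen_domain.eventually_mem hu] with v hv
    have h2 : f =ᶠ[nhds v] _ := (P.isOpen_domain.eventually_mem hv).mono hf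
    rw [h2.wirtingerBar_eq, ((hasWirtingerAt_log_norm_sq (P.differentiableAt_ν hv)
      (P.ν_ne_zero v hv)).sub ((HasWirtingerAt.const e v).mul
        (hasWirtingerAt_log_norm_sq (P.differentiableAt_Z hv) (P.Z_ne_zero v hv)))).3]
    simp
  rw [h1.wirtinger_eq, ((hasWirtingerAt_dotProduct_star_div P.isOpen_domain P.holomorphic_ν hu
    (P.ν_ne_zero u hu) j).sub ((HasWirtingerAt.const e u).mul
      (hasWirtingerAt_dotProduct_star_div P.isOpen_domain P.holomorphic_Z hu
        (P.Z_ne_zero u hu) j))).2, metric_apply]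
  simp

end ConormalPatch

namespace HolomorphicCoordinates

variable {n d : ℕ} {F : MvPolynomial (Fin (n + 1)) ℂ}

/-- The gradient `(F_0, …, F_n)` of `F` along a holomorphic coordinate system. -/
def gradient {m : ℕ} {M : Set (Projectivization ℂ (Fin (n + 1) → ℂ))} (φ : HolomorphicCoordinates M m)
    (F : MvPolynomial (Fin (n + 1)) ℂ) (u : Fin m → ℂ) : Fin (n + 1) → ℂ :=
  fun k => MvPolynomial.eval (φ.lift u) (MvPolynomial.pderiv k F)

section

variable {m : ℕ} (φ : HolomorphicCoordinates (hypersurface F) m)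

theorem eval_lift {u : Fin m → ℂ} (hu : u ∈ φ.domain) :
    MvPolynomial.eval (φ.lift u) F = 0 :=
  φ.mem u hu _ (φ.lift_ne_zero u hu) rfl

theorem differentiableAt_lift {u : Fin m → ℂ} (hu : u ∈ φ.domain) :
    DifferentiableAt ℂ φ.lift u :=
  φ.holomorphic.differentiableAt (φ.isOpen_domain.mem_nhds hu)

/-- Euler's identity on the hypersurface. -/
theorem gradient_dot_lift (hF : F.IsHomogeneous d) {u : Fin m → ℂ} (hu : u ∈ φ.domain) :
    φ.gradient F u ⬝ᵥ φ.lift u = 0 := by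
  have h := congrArg (MvPolynomial.eval (φ.lift u)) hF.sum_X_mul_pderiv
  simp only [map_sum, map_mul, MvPolynomial.eval_X, map_nsmul, φ.eval_lift hu, smul_zero] at h
  rw [dotProduct_comm]
  exact h

theorem gradient_dot_partialDeriv {u : Fin m → ℂ} (hu : u ∈ φ.domain) (i : Fin m) :
    φ.gradient F u ⬝ᵥ partialDeriv i φ.lift u = 0 := by
  have h1 := (hasFDerivAt_eval F (φ.lift u)).comp u (φ.differentiableAt_lift hu).hasFDerivAt
  have h2 : (fun v => MvPolynomial.eval (φ.lift v) F) =ᶠ[nhds u] fun _ => 0 :=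
    (φ.isOpen_domain.eventually_mem hu).mono fun v hv => φ.eval_lift hv
  have h3 := h1.unique ((hasFDerivAt_const (0 : ℂ) u).congr_of_eventuallyEq h2)
  have h4 := congrArg (fun T : (Fin m → ℂ) →L[ℂ] ℂ => T (Pi.single i 1)) h3
  simpa [dotProduct, gradient, partialDeriv] using h4

end

variable (φ : HolomorphicCoordinates (hypersurface F) (n - 1))

/-- For `n = 0` the hypersurface of a nonsingular equation is empty. -/
theorem dim_pos (hF : F.IsHomogeneous d) (hs : IsNonsingular F) {u : Fin (n - 1) → ℂ}
    (hu : u ∈ φ.domain) : 1 ≤ n := by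
  by_contra hn
  obtain rfl : n = 0 := by omega
  obtain ⟨k, hk⟩ := hs _ (φ.lift_ne_zero u hu) (φ.eval_lift hu)
  have h := φ.gradient_dot_lift hF hu
  rw [dotProduct, Fin.sum_univ_one] at h
  refine φ.lift_ne_zero u hu (funext fun l => ?_)
  rw [Fin.fin_one_eq_zero k] at hk
  rw [Fin.fin_one_eq_zero l]
  exact (mul_eq_zero.mp h).resolve_left hk

/-- A holomorphic coordinate system of a nonsingular hypersurface, with the gradient of the
equation as conormal vector. -/
def toConormalPatch (hn : 1 ≤ n) (hF : F.IsHomogeneous d) (hs : IsNonsingular F) :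
    ConormalPatch n (n - 1) where
  domain := φ.domain
  isOpen_domain := φ.isOpen_domain
  Z := φ.lift
  ν := φ.gradient F
  holomorphic_Z := φ.holomorphic
  holomorphic_ν := differentiableOn_pi.mpr fun k u hu =>
    ((hasFDerivAt_eval _ (φ.lift u)).differentiableAt.comp u
      (φ.differentiableAt_lift hu)).differentiableWithinAt
  Z_ne_zero := φ.lift_ne_zero
  ν_ne_zero u hu := by
    obtain ⟨k, hk⟩ := hs _ (φ.lift_ne_zero u hu) (φ.eval_lift hu)
    exact fun h => hk (congrFun h k)
  ν_dot_Z _ hu := φ.gradient_dot_lift hF hu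
  ν_dot_partialDeriv _ hu := φ.gradient_dot_partialDeriv hu
  immersion := φ.immersion
  dim_eq := by omega

end HolomorphicCoordinates

theorem xi_eq_log_sub_log {n : ℕ} (F : MvPolynomial (Fin (n + 1)) ℂ) (d : ℕ)
    {Z : Fin (n + 1) → ℂ} (hZ : Z ≠ 0)
    (hF : (fun k => MvPolynomial.eval Z (MvPolynomial.pderiv k F)) ≠ 0) :
    xi F d Z = Real.log (∑ k, ‖MvPolynomial.eval Z (MvPolynomial.pderiv k F)‖ ^ 2) -
      (d - 1 : ℕ) * Real.log (∑ k, ‖Z k‖ ^ 2) := by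
  rw [xi, Real.log_div (sum_norm_sq_ne_zero hF) (pow_ne_zero _ (sum_norm_sq_ne_zero hZ)),
    Real.log_pow]

end ProjHypersurface

end

/-- Let `M = {F = 0} ⊂ ℂPⁿ` be a nonsingular hypersurface of degree `d`, with the metric
`ω = ω_FS|_M` and the curvature matrix `Θ`. In every holomorphic coordinate system of `M`,
`∑ Θ_{i₁}^{i₂} ∧ Θ_{i₂}^{i₃} ∧ ⋯ ∧ Θ_{i_j}^{i₁} = (n+1) ω^j - (d ω + (√-1/2π) ∂∂̄ξ)^j`
for `j ≥ 2`. -/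
theorem theorem2p1 (n d : ℕ) (hd : 1 ≤ d) (F : MvPolynomial (Fin (n + 1)) ℂ)
    (hF : F.IsHomogeneous d) (hs : IsNonsingular F)
    (φ : HolomorphicCoordinates (hypersurface F) (n - 1))
    (u : Fin (n - 1) → ℂ) (hu : u ∈ φ.domain) (j : ℕ) (hj : 2 ≤ j) :
    Matrix.trace (φ.curvature u ^ j) =
      ((n : ℂ) + 1) • φ.omega u ^ j - ((d : ℂ) • φ.omega u + φ.ddbarXi F d u) ^ j := by
  have hn := φ.dim_pos hF hs hu
  set P := φ.toConormalPatch hn hF hs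
  have huP : u ∈ P.domain := hu
  obtain ⟨s, t, hs', ht, hcurv, hlog⟩ := P.exists_gauss_equation huP
  have hΘ : ∀ k l, φ.curvature u k l = oneOneForm (Matrix.of fun i j =>
      P.metric u k j * (if i = l then 1 else 0) + P.metric u i j * (if k = l then 1 else 0) +
        s i k * t j l) := fun k l => by
    simp only [← hcurv]
    rfl
  have hxi : φ.ddbarXi F d u =
      oneOneForm ((-1 : ℂ) • (s * Matrix.transpose t) + (-((d - 1 : ℕ) : ℂ)) • P.metric u) := by
    refine congrArg oneOneForm ?_
    ext i l
    rw [Matrix.of_apply, P.wirtinger_wirtingerBar_of_eq_log huP (e := ((d - 1 : ℕ) : ℂ))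
      (fun v hv => ?_), hlog]
    · simp [Matrix.mul_apply, sub_eq_add_neg]
    · rw [xi_eq_log_sub_log F d (φ.lift_ne_zero v hv) (P.ν_ne_zero v hv)]
      push_cast
      rfl
  have hsum : (d : ℂ) • φ.omega u + φ.ddbarXi F d u =
      oneOneForm (P.metric u) - oneOneForm (s * Matrix.transpose t) := by
    rw [hxi, oneOneForm_add, oneOneForm_smul, oneOneForm_smul, Nat.cast_sub hd]
    change (d : ℂ) • oneOneForm (P.metric u) + _ = _
    push_cast
    module
  have hdim : ((n - 1 : ℕ) : ℂ) + 2 = (n : ℂ) + 1 := by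
    rw [Nat.cast_sub hn]
    push_cast
    ring
  rw [trace_pow_of_gauss_equation hs' ht hΘ (by omega), hsum, hdim]
  rfl
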